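/- Let $P_0(x)=1$, $P_1(x)=2x-1$, $P_{n+1}(x)=\frac{2n+1}{n+1}(2x-1)P_n(x)-\frac{n}{n+1}P_{n-1}(x)$ be the shifted Legendre polynomials. For a function $A$ with values in a real Banach algebra, and for a base point $t_0$ and a step $h$, put $$A_n=(2n-1)\,h\int_0^1 P_{n-1}(x)\,A(t_0+xh)\,dx .$$ A real array $f=(f_{i,n})_{1\le i\le s,\,1\le n\le 3}$ defines the commutator-free exponential time-propagator (CFET) $$\tilde U_f(t_0+h,t_0)=e^{\Omega_1}e^{\Omega_2}\cdots e^{\Omega_s},\qquad \Omega_i=\sum_{n=1}^{3}f_{i,n}A_n .$$ It is time-symmetric if $f_{s-i+1,n}=(-1)^{n+1}f_{i,n}$ for all $i,n$. It is of 6th order if, for every real Banach algebra, all $t_0$ and $T>0$, every $A$ of class $C^6$ on $[t_0,t_0+T]$, and the solution $U$ of $U'=AU$, $U(t_0)=1$ on $[t_0,t_0+T]$, one has $\tilde U_f(t_0+h,t_0)-U(t_0+h)=O(h^7)$ as $h\to0^+$. For $s=5$ and $f$ time-symmetric (so $f_{3,2}=0$ and the last two rows are determined by the first two), the seven 6th-order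 order conditions, belonging to $A_1$, $A_3$, $[A_1,A_2]$, $[A_2,A_3]$, $[A_1,[A_1,A_3]]$, $[A_2,[A_1,A_2]]$, $[A_1,[A_1,[A_1,A_2]]]$, are \begin{align*} 1&=2f_{1,1}+2f_{2,1}+f_{3,1},\\ 0&=2f_{1,3}+2f_{2,3}+f_{3,3},\\ -\tfrac16&=-f_{1,1}f_{1,2}-2f_{2,1}f_{1,2}-f_{2,1}f_{2,2}-f_{3,1}f_{1,2}-f_{3,1}f_{2,2},\\ -\tfrac1{30}&=f_{1,2}f_{1,3}+2f_{1,2}f_{2,3}+f_{1,2}f_{3,3}+f_{2,2}f_{2,3}+f_{2,2}f_{3,3},\\ \tfrac1{60}&=\tfrac13f_{1,1}f_{2,1}f_{1,3}-\tfrac23f_{1,1}f_{2,1}f_{2,3}-\tfrac13f_{1,1}f_{2,1}f_{3,3}+\tfrac16f_{1,1}f_{3,1}f_{1,3}-\tfrac13f_{1,1}f_{3,1}f_{2,3}-\tfrac16f_{1,1}f_{3,1}f_{3,3}\\ &\quad-\tfrac13f_{1,1}^2f_{2,3}-\tfrac16f_{1,1}^2f_{3,3}+\tfrac23f_{2,1}f_{3,1}f_{1,3}+\tfrac16f_{2,1}f_{3,1}f_{2,3}-\tfrac16f_{2,1}f_{3,1}f_{3,3}+\tfrac23f_{2,1}^2f_{1,3}\\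 &\quad-\tfrac16f_{2,1}^2f_{3,3}+\tfrac16f_{3,1}^2f_{1,3}+\tfrac16f_{3,1}^2f_{2,3},\\ -\tfrac1{60}&=-\tfrac13f_{1,1}f_{1,2}^2-f_{2,1}f_{1,2}f_{2,2}-f_{2,1}f_{1,2}^2-\tfrac13f_{2,1}f_{2,2}^2-f_{3,1}f_{1,2}f_{2,2}-\tfrac12f_{3,1}f_{1,2}^2-\tfrac12f_{3,1}f_{2,2}^2,\\ \tfrac1{360}&=\tfrac13f_{1,1}f_{2,1}f_{3,1}f_{1,2}+\tfrac12f_{1,1}f_{2,1}f_{3,1}f_{2,2}+\tfrac13f_{1,1}f_{2,1}^2f_{1,2}+\tfrac13f_{1,1}f_{2,1}^2f_{2,2}+\tfrac1{12}f_{1,1}f_{3,1}^2f_{1,2}\\ &\quad+\tfrac16f_{1,1}f_{3,1}^2f_{2,2}+\tfrac13f_{1,1}^2f_{2,1}f_{1,2}+\tfrac16f_{1,1}^2f_{2,1}f_{2,2}+\tfrac16f_{1,1}^2f_{3,1}f_{1,2}+\tfrac16f_{1,1}^2f_{3,1}f_{2,2}+\tfrac1{12}f_{1,1}^3f_{1,2}\\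 &\quad+\tfrac1{12}f_{2,1}f_{3,1}^2f_{2,2}+\tfrac16f_{2,1}^2f_{3,1}f_{2,2}+\tfrac1{12}f_{2,1}^3f_{2,2}. \end{align*} **(1) CF6:4.** Let $$f_{1,1}=\frac12+\frac{(5400-600\sqrt6)^{1/3}}{60}+\frac{\big(\frac15(9+\sqrt6)\big)^{1/3}}{2\cdot3^{2/3}},\quad f_{1,2}=f_{1,1}-\tfrac23f_{1,1}^2,\quad f_{1,3}=\frac1{10-10f_{1,1}},$$ $$f_{2,1}=\tfrac12-f_{1,1},\quad f_{2,2}=\tfrac13(1-4f_{1,1}+2f_{1,1}^2),\quad f_{2,3}=-f_{1,3},\quad f_{3,1}=f_{3,2}=f_{3,3}=0,$$ and extend this to a time-symmetric array with five rows. It satisfies all seven order conditions; its central exponential is trivial, so that its CFET is equal to the time-symmetric CFET with only $4$ exponentials that is obtained by deleting the zero row; and this 4-exponential CFET is of 6th order. **(2)** Every time-symmetric array with $s=5$ that satisfies the seven order conditions defines a CFET of 6th order. **(3) Reduction for 5 exponentials.** Let \begin{align*} p(x,y)={}&-2+30x-192x^2+680x^3-1440x^4+1815x^5-1250x^6+360x^7\\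 &+(18-232x+1230x^2-3440x^3+5345x^4-4350x^5+1440x^6)\,y\\ &+(-60+650x-2740x^2+5655x^3-5710x^4+2250x^5)\,y^2\\ &+(90-800x+2535x^2-3450x^3+1710x^4)\,y^3\\ &+(-60+425x-920x^2+630x^3)\,y^4+(15-80x+90x^2)\,y^5, \end{align*} which has degree $5$ in $y$ (as a polynomial in $y$ over $\mathbb R[x]$). For a time-symmetric array with $s=5$ for which none of the denominators in the following formulas vanishes (the values being computed successively from $f_{1,1}$ and $f_{2,1}$), the seven order conditions hold if and only if $p(f_{1,1},f_{2,1})=0$ and \begin{align*} f_{2,2}&=\frac{1+5f_{1,1}(f_{1,1}-1)}{30(f_{1,1}+f_{2,1}-1)(f_{1,1}+f_{2,1})(2f_{1,1}+f_{2,1}-1)},\qquad f_{1,2}=\frac{1-6f_{2,2}+12f_{1,1}f_{2,2}+6f_{2,1}f_{2,2}}{6(1-f_{1,1})},\\ f_{1,3}&=\frac{(2f_{1,1}-1)(2f_{1,1}+f_{2,1}-1)-3f_{2,2}}{30D},\qquad f_{2,3}=\frac{f_{1,1}+3f_{1,2}+4f_{1,1}f_{2,1}+2(f_{2,1}-1)f_{2,1}+6f_{2,2}-1}{30D},\\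 f_{3,1}&=1-2f_{1,1}-2f_{2,1},\qquad f_{3,3}=-2f_{1,3}-2f_{2,3}, \end{align*} where $D=f_{1,2}(2f_{1,1}-1)(2f_{1,1}+f_{2,1}-1)+f_{2,2}\big(1+8f_{1,1}^2+2(f_{2,1}-2)f_{2,1}+(8f_{2,1}-7)f_{1,1}\big)$. -/

import Mathlib

open Set Filter Topology Asymptotics

universe u

namespace CFET

noncomputable section

/-- The shifted Legendre polynomials `P_n` on `[0, 1]`. -/
def shiftedLegendreP : ℕ → ℝ → ℝ
  | 0, _ => 1
  | 1, x => 2 * x - 1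
  | n + 2, x =>
      (2 * (n : ℝ) + 3) / ((n : ℝ) + 2) * (2 * x - 1) * shiftedLegendreP (n + 1) x
        - ((n : ℝ) + 1) / ((n : ℝ) + 2) * shiftedLegendreP n x

section Propagators

variable {𝔸 : Type u} [NormedRing 𝔸] [NormedAlgebra ℝ 𝔸]

/-- The Legendre coefficients of `A` on the interval `[t₀, t₀ + h]`. Indices start at zero:
`legendreCoeff A t₀ h n` is the coefficient usually written `A_{n+1}`, that is
`A_{n+1} = (2n+1) h ∫₀¹ P_n(x) A(t₀ + x h) dx`. -/
def legendreCoeff (A : ℝ → 𝔸) (t₀ h : ℝ) (n : ℕ) : 𝔸 :=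
  ((2 * (n : ℝ) + 1) * h) • ∫ x in (0 : ℝ)..1, shiftedLegendreP n x • A (t₀ + x * h)

/-- The exponent `Ω_i = ∑_n f_{i,n} A_n` built from one row of the coefficient array. -/
def exponent {N : ℕ} (c : Fin N → ℝ) (A : ℝ → 𝔸) (t₀ h : ℝ) : 𝔸 :=
  ∑ n : Fin N, c n • legendreCoeff A t₀ h n

/-- The commutator-free exponential time-propagator `e^{Ω_1} e^{Ω_2} ⋯ e^{Ω_s}` over the step from
`t₀` to `t₀ + h`, the factors being multiplied from left to right. The entry `f i n` of the
coefficient array (indices from zero) is the coefficient `f_{i+1,n+1}`. -/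
def propagator {s N : ℕ} (f : Fin s → Fin N → ℝ) (A : ℝ → 𝔸) (t₀ h : ℝ) : 𝔸 :=
  (List.ofFn fun i : Fin s => NormedSpace.exp (exponent (f i) A t₀ h)).prod

/-- `U` is the exact propagator `t ↦ U(t, t₀)` of `∂ₜ x = A(t) x` on `[t₀, t₀ + T]`. -/
def IsExactPropagator (A U : ℝ → 𝔸) (t₀ T : ℝ) : Prop :=
  U t₀ = 1 ∧ ∀ t ∈ Icc t₀ (t₀ + T), HasDerivWithinAt U (A t * U t) (Icc t₀ (t₀ + T)) t

end Propagators

/-- The coefficient array `f` defines a CFET of order `p`: for every sufficiently regular `A` with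
values in a Banach algebra, the one-step error is `O(h ^ (p + 1))` as `h → 0+`. -/
def IsOfOrder (p : ℕ) {s N : ℕ} (f : Fin s → Fin N → ℝ) : Prop :=
  ∀ (𝔸 : Type u) [NormedRing 𝔸] [NormedAlgebra ℝ 𝔸] [CompleteSpace 𝔸]
    (A U : ℝ → 𝔸) (t₀ T : ℝ), 0 < T → ContDiffOn ℝ p A (Icc t₀ (t₀ + T)) →
    IsExactPropagator A U t₀ T →
    (fun h : ℝ => propagator f A t₀ h - U (t₀ + h)) =O[𝓝[>] 0] fun h : ℝ => h ^ (p + 1)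

/-- Time symmetry `f_{s-i+1,n} = (-1)^{n+1} f_{i,n}` (here with indices from zero). -/
def IsTimeSymmetric {s N : ℕ} (f : Fin s → Fin N → ℝ) : Prop :=
  ∀ i n, f i.rev n = (-1) ^ (n : ℕ) * f i n

/-- The seven order conditions for a time-symmetric 6th-order CFET with five exponentials, one for
each of the Hall basis elements `A₁`, `A₃`, `[A₁,A₂]`, `[A₂,A₃]`, `[A₁,[A₁,A₃]]`, `[A₂,[A₁,A₂]]`,
`[A₁,[A₁,[A₁,A₂]]]`, in this order. -/
def SixthOrderConditions (f : Fin 5 → Fin 3 → ℝ) : Prop :=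
  let f11 := f 0 0
  let f12 := f 0 1
  let f13 := f 0 2
  let f21 := f 1 0
  let f22 := f 1 1
  let f23 := f 1 2
  let f31 := f 2 0
  let f33 := f 2 2
  1 = 2 * f11 + 2 * f21 + f31 ∧
  0 = 2 * f13 + 2 * f23 + f33 ∧
  -(1 / 6) = -(f11 * f12) - 2 * f21 * f12 - f21 * f22 - f31 * f12 - f31 * f22 ∧
  -(1 / 30) = f12 * f13 + 2 * f12 * f23 + f12 * f33 + f22 * f23 + f22 * f33 ∧
  1 / 60 = 1 / 3 * f11 * f21 * f13 - 2 / 3 * f11 * f21 * f23 - 1 / 3 * f11 * f21 * f33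
    + 1 / 6 * f11 * f31 * f13 - 1 / 3 * f11 * f31 * f23 - 1 / 6 * f11 * f31 * f33
    - 1 / 3 * f11 ^ 2 * f23 - 1 / 6 * f11 ^ 2 * f33 + 2 / 3 * f21 * f31 * f13
    + 1 / 6 * f21 * f31 * f23 - 1 / 6 * f21 * f31 * f33 + 2 / 3 * f21 ^ 2 * f13
    - 1 / 6 * f21 ^ 2 * f33 + 1 / 6 * f31 ^ 2 * f13 + 1 / 6 * f31 ^ 2 * f23 ∧
  -(1 / 60) = -(1 / 3 * f11 * f12 ^ 2) - f21 * f12 * f22 - f21 * f12 ^ 2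
    - 1 / 3 * f21 * f22 ^ 2 - f31 * f12 * f22 - 1 / 2 * f31 * f12 ^ 2
    - 1 / 2 * f31 * f22 ^ 2 ∧
  1 / 360 = 1 / 3 * f11 * f21 * f31 * f12 + 1 / 2 * f11 * f21 * f31 * f22
    + 1 / 3 * f11 * f21 ^ 2 * f12 + 1 / 3 * f11 * f21 ^ 2 * f22 + 1 / 12 * f11 * f31 ^ 2 * f12
    + 1 / 6 * f11 * f31 ^ 2 * f22 + 1 / 3 * f11 ^ 2 * f21 * f12 + 1 / 6 * f11 ^ 2 * f21 * f22
    + 1 / 6 * f11 ^ 2 * f31 * f12 + 1 / 6 * f11 ^ 2 * f31 * f22 + 1 / 12 * f11 ^ 3 * f12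
    + 1 / 12 * f21 * f31 ^ 2 * f22 + 1 / 6 * f21 ^ 2 * f31 * f22 + 1 / 12 * f21 ^ 3 * f22

/-! The scheme CF6:4. -/

/-- The coefficient `f_{1,1}` of CF6:4. -/
def cf64f11 : ℝ :=
  1 / 2 + (5400 - 600 * √6) ^ (1 / 3 : ℝ) / 60
    + (1 / 5 * (9 + √6)) ^ (1 / 3 : ℝ) / (2 * (3 : ℝ) ^ (2 / 3 : ℝ))

/-- The coefficients `f_{i,n}` of CF6:4 for `1 ≤ i, n ≤ 3`. -/
def cf64Table : Fin 3 → Fin 3 → ℝ :=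
  ![![cf64f11, cf64f11 - 2 / 3 * cf64f11 ^ 2, 1 / (10 - 10 * cf64f11)],
    ![1 / 2 - cf64f11, 1 / 3 * (1 - 4 * cf64f11 + 2 * cf64f11 ^ 2), -(1 / (10 - 10 * cf64f11))],
    ![0, 0, 0]]

/-- CF6:4 with its trivial central exponential written out (`s = 5`). -/
def cf64Padded : Fin 5 → Fin 3 → ℝ :=
  ![cf64Table 0, cf64Table 1, cf64Table 2,
    fun n => (-1) ^ (n : ℕ) * cf64Table 1 n, fun n => (-1) ^ (n : ℕ) * cf64Table 0 n]

/-- CF6:4 as an array for four exponentials. -/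
def cf64 : Fin 4 → Fin 3 → ℝ :=
  ![cf64Table 0, cf64Table 1,
    fun n => (-1) ^ (n : ℕ) * cf64Table 1 n, fun n => (-1) ^ (n : ℕ) * cf64Table 0 n]

/-! The reduction for five exponentials. -/

/-- The polynomial `p(x, y)`, as a polynomial in `y` over `ℝ[x]`. -/
def orderPoly : Polynomial (Polynomial ℝ) :=
  let x : Polynomial (Polynomial ℝ) := Polynomial.C Polynomial.X
  let y : Polynomial (Polynomial ℝ) := Polynomial.X
  (-2 + 30 * x - 192 * x ^ 2 + 680 * x ^ 3 - 1440 * x ^ 4 + 1815 * x ^ 5 - 1250 * x ^ 6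
      + 360 * x ^ 7)
    + (18 - 232 * x + 1230 * x ^ 2 - 3440 * x ^ 3 + 5345 * x ^ 4 - 4350 * x ^ 5
      + 1440 * x ^ 6) * y
    + (-60 + 650 * x - 2740 * x ^ 2 + 5655 * x ^ 3 - 5710 * x ^ 4 + 2250 * x ^ 5) * y ^ 2
    + (90 - 800 * x + 2535 * x ^ 2 - 3450 * x ^ 3 + 1710 * x ^ 4) * y ^ 3
    + (-60 + 425 * x - 920 * x ^ 2 + 630 * x ^ 3) * y ^ 4
    + (15 - 80 * x + 90 * x ^ 2) * y ^ 5

/-- `f_{2,2}` in terms of `x = f_{1,1}` and `y = f_{2,1}`. -/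
def rem22 (x y : ℝ) : ℝ :=
  (1 + 5 * x * (x - 1)) / (30 * (x + y - 1) * (x + y) * (2 * x + y - 1))

/-- `f_{1,2}` in terms of `x = f_{1,1}` and `y = f_{2,1}`. -/
def rem12 (x y : ℝ) : ℝ :=
  (1 - 6 * rem22 x y + 12 * x * rem22 x y + 6 * y * rem22 x y) / (6 * (1 - x))

/-- The common denominator of `f_{1,3}` and `f_{2,3}`, without the factor `30`. -/
def remDenom (x y : ℝ) : ℝ :=
  rem12 x y * (2 * x - 1) * (2 * x + y - 1)
    + rem22 x y * (1 + 8 * x ^ 2 + 2 * (y - 2) * y + (8 * y - 7) * x)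

/-- `f_{1,3}` in terms of `x = f_{1,1}` and `y = f_{2,1}`. -/
def rem13 (x y : ℝ) : ℝ :=
  ((2 * x - 1) * (2 * x + y - 1) - 3 * rem22 x y) / (30 * remDenom x y)

/-- `f_{2,3}` in terms of `x = f_{1,1}` and `y = f_{2,1}`. -/
def rem23 (x y : ℝ) : ℝ :=
  (x + 3 * rem12 x y + 4 * x * y + 2 * (y - 1) * y + 6 * rem22 x y - 1) / (30 * remDenom x y)

/-- No denominator in the formulas for the remaining coefficients vanishes. -/
def Nondegenerate (x y : ℝ) : Prop :=
  x + y - 1 ≠ 0 ∧ x + y ≠ 0 ∧ 2 * x + y - 1 ≠ 0 ∧ 1 - x ≠ 0 ∧ remDenom x y ≠ 0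

end

end CFET

namespace CFET

/-! ### Formal series indexed by words -/

/-! Both the product of exponentials and the exact propagator are expanded over words in letters `a
0, a 1, …`, the Legendre coefficients of the degree-five Taylor polynomial of `A`. Orthogonality
makes the letter `l` of size `O(h ^ (l + 1))`, hence its weight `l + 1`; sixth order follows once
the two coefficient series agree on all words of weight at most 6. One analytic lemma gives both
expansions: `IsIteratedIntegral.hasWordExpansion` compares the solution of a linear ODE with its
truncated series of iterated integrals by Gronwall's inequality. Constant coefficients give the
exponentials, Legendre polynomials the exact propagator.

The series are compared in `propWord_eq_dysonWord`. Time symmetry says that changing the sign of the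
odd weights inverts the series (`alt_propWord`, `dysonWord_alt_inverse`), so the values in an even
weight are determined by the lower ones (`eq_of_alt_inverse`). In weights 1, 3, 5 letters from 3 on
contribute zero on both sides, and the shuffle relations with one letter reduce the rest to seven
Lyndon words, whose values are what the seven order conditions prescribe (`propWord_lyndon`).

For CF6:4, Cardano's formula shows that `cf64f11` is a root of a cubic, and the order conditions
hold modulo this cubic. In the reduction, two conditions determine `f 1 1` and `f 0 1`, two more
form a linear system for `f 0 2` and `f 1 2`, and the condition quadratic in `f 0 1` and `f 1 1`
becomes `orderPoly` after clearing denominators. -/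

/-- The weight of a word; the letter `l` has weight `l + 1`. -/
def weight (w : List ℕ) : ℕ := (w.map (· + 1)).sum

@[simp] theorem weight_nil : weight [] = 0 := rfl

@[simp] theorem weight_cons (l : ℕ) (w : List ℕ) : weight (l :: w) = l + 1 + weight w := by
  simp [weight]

theorem weight_append (u v : List ℕ) : weight (u ++ v) = weight u + weight v := by
  simp [weight]

/-- The words of a given weight. -/
def words : ℕ → List (List ℕ)
  | 0 => [[]]
  | k + 1 => (words k).flatMap fun w =>
      match w with
      | [] => [[0]]
      | l :: v => [0 :: l :: v, (l + 1) :: v]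

/-- A nonempty word arises from a word of weight one less by prefixing the letter `0` or by raising
its first letter. This completeness lets finite checks over `words k` speak about all words of
weight `k`. -/
theorem mem_words_weight (w : List ℕ) : w ∈ words (weight w) := by
  suffices h : ∀ k w, weight w = k → w ∈ words k from h _ w rfl
  intro k
  induction k with
  | zero =>
    intro w hw
    cases w with
    | nil => simp [words]
    | cons l v => simp at hw
  | succ k ih =>
    intro w hw
    rw [words, List.mem_flatMap]
    match w, hw with
    | [], hw => simp at hw
    | [0], hw => exact ⟨[], ih _ (by simp at hw ⊢; omega), by simp⟩
    | 0 :: l :: v, hw => exact ⟨l :: v, ih _ (by simp at hw ⊢; omega), by simp⟩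
    | (l + 1) :: v, hw => exact ⟨l :: v, ih _ (by simp at hw ⊢; omega), by simp⟩

section Conv

variable {R : Type*} [CommRing R]

/-- The concatenation product of two series. -/
def wordConv : (List ℕ → R) → (List ℕ → R) → List ℕ → R
  | S, T, [] => S [] * T []
  | S, T, l :: w => S [] * T (l :: w) + wordConv (fun v => S (l :: v)) T w

/-- The unit series. -/
def wordOne : List ℕ → R
  | [] => 1
  | _ :: _ => 0

theorem wordConv_zero_left (T : List ℕ → R) (w : List ℕ) : wordConv (fun _ => 0) T w = 0 := by
  induction w with
  | nil => simp [wordConv]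
  | cons l w ih => simp [wordConv, ih]

theorem wordConv_add_left (S S' T : List ℕ → R) (w : List ℕ) :
    wordConv (fun v => S v + S' v) T w = wordConv S T w + wordConv S' T w := by
  induction w generalizing S S' with
  | nil => simp [wordConv, add_mul]
  | cons l w ih => simp only [wordConv, ih]; ring

theorem wordConv_smul_left (c : R) (S T : List ℕ → R) (w : List ℕ) :
    wordConv (fun v => c * S v) T w = c * wordConv S T w := by
  induction w generalizing S with
  | nil => simp [wordConv, mul_assoc]
  | cons l w ih => simp only [wordConv, ih]; ring

theorem wordConv_assoc (S T Q : List ℕ → R) :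
    wordConv (wordConv S T) Q = wordConv S (wordConv T Q) := by
  funext w
  induction w generalizing S with
  | nil => simp [wordConv, mul_assoc]
  | cons l w ih =>
    simp only [wordConv, wordConv_add_left, wordConv_smul_left, ih]; ring

theorem wordConv_one_left (T : List ℕ → R) : wordConv wordOne T = T := by
  funext w
  cases w with
  | nil => simp [wordConv, wordOne]
  | cons l w => simp [wordConv, wordOne, wordConv_zero_left]

theorem wordConv_eq_sum (S T : List ℕ → R) (w : List ℕ) :
    wordConv S T w = ∑ i ∈ Finset.range (w.length + 1), S (w.take i) * T (w.drop i) := by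
  induction w generalizing S with
  | nil => simp [wordConv]
  | cons l w ih =>
    rw [List.length_cons, Finset.sum_range_succ']
    simp [wordConv, ih, add_comm]

/-! ### The alternating twist -/

/-- The series `S` with the sign `(-1)^k` in weight `k`. -/
def alt (S : List ℕ → R) (w : List ℕ) : R := (-1) ^ weight w * S w

/-- Weight is additive under concatenation, so the sign splits along every cut of the word. -/
theorem alt_wordConv (S T : List ℕ → R) : alt (wordConv S T) = wordConv (alt S) (alt T) := by
  funext w
  rw [alt, wordConv_eq_sum, wordConv_eq_sum, Finset.mul_sum]
  refine Finset.sum_congr rfl fun i _ => ?_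
  conv_lhs => rw [← List.take_append_drop i w, weight_append]
  simp only [List.take_append_drop, alt]
  ring

theorem wordConv_eq_zero_of_mem {S T : List ℕ → R} {l : ℕ} (hS : ∀ w, l ∈ w → S w = 0)
    (hT : ∀ w, l ∈ w → T w = 0) (w : List ℕ) (hw : l ∈ w) : wordConv S T w = 0 := by
  rw [wordConv_eq_sum]
  refine Finset.sum_eq_zero fun i _ => ?_
  rw [← List.take_append_drop i w, List.mem_append] at hw
  rcases hw with hw | hw
  · rw [hS _ hw, zero_mul]
  · rw [hT _ hw, mul_zero]

/-- Two series inverse to their own alternating twist that agree in weights below an even number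
agree in that weight. -/
theorem eq_of_alt_inverse [NoZeroDivisors R] [CharZero R] {S T : List ℕ → R} {w : List ℕ}
    (hw : w ≠ []) (heven : Even (weight w)) (hS1 : S [] = 1) (hT1 : T [] = 1)
    (hS : wordConv (alt S) S w = 0) (hT : wordConv (alt T) T w = 0)
    (h : ∀ v, weight v < weight w → S v = T v) : S w = T w := by
  obtain ⟨n, hn⟩ : ∃ n, w.length = n + 1 :=
    Nat.exists_eq_succ_of_ne_zero (by simpa using hw)
  rw [wordConv_eq_sum, Finset.sum_range_succ, hn, Finset.sum_range_succ'] at hS hT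
  have hl : w.take (n + 1) = w := by rw [← hn, List.take_length]
  have hd : w.drop (n + 1) = [] := by rw [← hn, List.drop_length]
  simp only [List.take_zero, List.drop_zero, hl, hd, alt, heven.neg_one_pow, weight_nil,
    pow_zero, hS1, hT1] at hS hT
  -- The two trivial cuts each contribute `S w`, with sign `+1` because the weight is even. At every
  -- other cut both pieces are nonempty, so their weights are smaller and `h` applies.
  have key : ∀ i ∈ Finset.range n,
      (-1) ^ weight (w.take (i + 1)) * S (w.take (i + 1)) * S (w.drop (i + 1))
        = (-1) ^ weight (w.take (i + 1)) * T (w.take (i + 1)) * T (w.drop (i + 1)) := by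
    intro i hi
    have hi' := Finset.mem_range.1 hi
    have hsum : weight (w.take (i + 1)) + weight (w.drop (i + 1)) = weight w := by
      rw [← weight_append, List.take_append_drop]
    have hpos : ∀ v : List ℕ, v.length ≠ 0 → 0 < weight v := by
      intro v hv
      cases v with
      | nil => simp at hv
      | cons l v => simp
    have h1 := hpos (w.take (i + 1)) (by simp; omega)
    have h2 := hpos (w.drop (i + 1)) (by simp; omega)
    rw [h _ (by omega), h _ (by omega)]
  rw [Finset.sum_congr rfl key] at hS
  have h2 : (2 : R) * (S w - T w) = 0 := by linear_combination hS - hT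
  rcases mul_eq_zero.1 h2 with h3 | h3
  · exact absurd h3 two_ne_zero
  · exact sub_eq_zero.1 h3

/-! ### Shuffle relations with one letter -/

/-- The sum of the values of `S` at all words obtained by inserting the letter `l`. -/
def insertSum (l : ℕ) : (List ℕ → R) → List ℕ → R
  | S, [] => S [l]
  | S, x :: w => S (l :: x :: w) + insertSum l (fun v => S (x :: v)) w

theorem insertSum_add (l : ℕ) (S T : List ℕ → R) (w : List ℕ) :
    insertSum l (fun v => S v + T v) w = insertSum l S w + insertSum l T w := by
  induction w generalizing S T with
  | nil => simp [insertSum]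
  | cons x w ih => simp only [insertSum, ih]; ring

theorem insertSum_smul (l : ℕ) (c : R) (S : List ℕ → R) (w : List ℕ) :
    insertSum l (fun v => c * S v) w = c * insertSum l S w := by
  induction w generalizing S with
  | nil => simp [insertSum]
  | cons x w ih => simp only [insertSum, ih]; ring

/-- After an insertion, each cut of the longer word leaves the new letter either in the left or in
the right piece; insertion is therefore a derivation of the concatenation product. -/
theorem insertSum_wordConv (l : ℕ) (S T : List ℕ → R) (w : List ℕ) :
    insertSum l (wordConv S T) w
      = wordConv (insertSum l S) T w + wordConv S (insertSum l T) w := by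
  induction w generalizing S with
  | nil => simp [insertSum, wordConv, add_comm]
  | cons x w ih =>
    have h := ih (fun v => S (x :: v))
    simp only [insertSum, wordConv, insertSum_add, insertSum_smul, wordConv_add_left, h]
    ring

/-- The shuffle relations with a single letter. -/
def ShufflesLetters (S : List ℕ → R) : Prop :=
  S [] = 1 ∧ ∀ l w, insertSum l S w = S [l] * S w

theorem ShufflesLetters.wordConv {S T : List ℕ → R} (hS : ShufflesLetters S)
    (hT : ShufflesLetters T) : ShufflesLetters (wordConv S T) := by
  refine ⟨by simp [CFET.wordConv, hS.1, hT.1], fun l w => ?_⟩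
  have h1 : insertSum l S = fun v => S [l] * S v := funext fun v => hS.2 l v
  have h2 : insertSum l T = fun v => T [l] * T v := funext fun v => hT.2 l v
  have h3 : ∀ (c : R) (S T : List ℕ → R),
      CFET.wordConv S (fun v => c * T v) w = c * CFET.wordConv S T w := by
    intro c S T
    simp only [wordConv_eq_sum, Finset.mul_sum]
    exact Finset.sum_congr rfl fun i _ => by ring
  rw [insertSum_wordConv, h1, h2, wordConv_smul_left, h3]
  simp only [CFET.wordConv, hS.1, hT.1]
  ring

end Conv

/-! ### The series of one exponential -/

/-- The series of the exponential of `∑ l, c l • l`. -/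
noncomputable def expWord (c : ℕ → ℝ) (w : List ℕ) : ℝ := (w.map c).prod / w.length.factorial

theorem expWord_shufflesLetters (c : ℕ → ℝ) : ShufflesLetters (expWord c) := by
  refine ⟨by simp [expWord], fun l w => ?_⟩
  -- The inverse factorial is replaced by an arbitrary function `r` of the length, so that the
  -- induction can absorb the first letter into `r`. All `w.length + 1` insertions give the same
  -- value.
  have key : ∀ (w : List ℕ) (r : ℕ → ℝ),
      insertSum l (fun v => (v.map c).prod * r v.length) w
        = (w.length + 1) * (c l * (w.map c).prod) * r (w.length + 1) := by
    intro w
    induction w with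
    | nil => intro r; simp [insertSum]
    | cons x w ih =>
      intro r
      have h := ih (fun n => c x * r (n + 1))
      have h' : (fun v : List ℕ => ((x :: v).map c).prod * r (x :: v).length)
          = fun v => (v.map c).prod * (c x * r (v.length + 1)) := by
        funext v; simp; ring
      rw [insertSum, h', h]
      simp
      ring
  have h := key w fun n => (n.factorial : ℝ)⁻¹
  simp only [← div_eq_mul_inv] at h
  change insertSum l (fun v => (v.map c).prod / (v.length.factorial : ℝ)) w = _
  rw [h, Nat.factorial_succ]
  simp [expWord]
  field_simp

/-- Up to the common factor `(w.map c).prod`, a cut enters only through the lengths of its pieces,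
so the identity is `exp(-X) exp(X) = 1` for power series in one variable. -/
theorem wordConv_expWord_neg (c : ℕ → ℝ) :
    wordConv (expWord fun l => -c l) (expWord c) = wordOne := by
  funext w
  have hneg : ∀ v : List ℕ, (v.map fun l => -c l).prod = (-1) ^ v.length * (v.map c).prod := by
    intro v
    induction v with
    | nil => simp
    | cons x v ih => simp [ih, pow_succ]; ring
  have h1 : wordConv (expWord fun l => -c l) (expWord c) w
      = (w.map c).prod * PowerSeries.coeff w.length
          (PowerSeries.evalNegHom (PowerSeries.exp ℝ) * PowerSeries.exp ℝ) := by
    rw [wordConv_eq_sum, PowerSeries.coeff_mul, Finset.Nat.sum_antidiagonal_eq_sum_range_succ_mk,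
      Finset.mul_sum]
    refine Finset.sum_congr rfl fun i hi => ?_
    have hi' : i ≤ w.length := Nat.lt_succ_iff.1 (Finset.mem_range.1 hi)
    have hp : (w.map c).prod = ((w.take i).map c).prod * ((w.drop i).map c).prod := by
      rw [← List.prod_append, ← List.map_append, List.take_append_drop]
    rw [hp, expWord, hneg, expWord]
    simp only [PowerSeries.evalNegHom, PowerSeries.coeff_rescale, PowerSeries.coeff_exp,
      List.length_take, List.length_drop, min_eq_left hi', map_div₀, map_one,
      map_natCast]
    ring
  rw [h1, mul_comm (PowerSeries.evalNegHom _), PowerSeries.exp_mul_exp_neg_eq_one]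
  cases w <;> simp [wordOne, PowerSeries.coeff_one]

/-! ### Iterated integrals of the Legendre polynomials -/

/-- The value of the polynomial with the given list of rational coefficients. -/
noncomputable def listEval (x : ℝ) : List ℚ → ℝ
  | [] => 0
  | a :: p => a + x * listEval x p

/-- Sum of coefficient lists. -/
def listAdd : List ℚ → List ℚ → List ℚ
  | [], q => q
  | p, [] => p
  | a :: p, b :: q => (a + b) :: listAdd p q

/-- Product of coefficient lists. -/
def listMul : List ℚ → List ℚ → List ℚ
  | [], _ => []
  | a :: p, q => listAdd (q.map (a * ·)) (0 :: listMul p q)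

/-- The quotient by `x ^ (n + 1)` of the antiderivative of `x ^ n` times a polynomial. -/
def listIntAux : ℕ → List ℚ → List ℚ
  | _, [] => []
  | n, a :: p => a / (n + 1) :: listIntAux (n + 1) p

/-- The antiderivative vanishing at zero. -/
def listInt (p : List ℚ) : List ℚ := 0 :: listIntAux 0 p

theorem listEval_add (x : ℝ) (p q : List ℚ) :
    listEval x (listAdd p q) = listEval x p + listEval x q := by
  induction p generalizing q with
  | nil => simp [listAdd, listEval]
  | cons a p ih =>
    cases q with
    | nil => simp [listAdd, listEval]
    | cons b q => simp [listAdd, listEval, ih]; ring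

theorem listEval_map_mul (x : ℝ) (a : ℚ) (p : List ℚ) :
    listEval x (p.map (a * ·)) = a * listEval x p := by
  induction p with
  | nil => simp [listEval]
  | cons b p ih => simp only [List.map_cons, listEval, ih]; push_cast; ring

theorem listEval_mul (x : ℝ) (p q : List ℚ) :
    listEval x (listMul p q) = listEval x p * listEval x q := by
  induction p with
  | nil => simp [listMul, listEval]
  | cons a p ih => simp [listMul, listEval, listEval_add, listEval_map_mul, ih]; ring

theorem listEval_one (p : List ℚ) : listEval 1 p = (p.sum : ℚ) := by
  induction p with
  | nil => simp [listEval]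
  | cons a p ih => simp [listEval, ih]

theorem hasDerivAt_listIntAux (n : ℕ) (p : List ℚ) (x : ℝ) :
    HasDerivAt (fun x => x ^ (n + 1) * listEval x (listIntAux n p)) (x ^ n * listEval x p) x := by
  induction p generalizing n with
  | nil => simpa [listIntAux, listEval] using hasDerivAt_const x (0 : ℝ)
  | cons a p ih =>
    have h := ((hasDerivAt_pow (n + 1) x).mul_const ((a : ℝ) / (n + 1))).add (ih (n + 1))
    refine (h.congr_deriv ?_).congr_of_eventuallyEq (Eventually.of_forall fun y => ?_)
    · simp only [listEval]
      push_cast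
      field_simp
      ring
    · simp only [listIntAux, listEval, Pi.add_apply]
      push_cast
      ring

theorem hasDerivAt_listInt (p : List ℚ) (x : ℝ) :
    HasDerivAt (fun x => listEval x (listInt p)) (listEval x p) x := by
  have h := hasDerivAt_listIntAux 0 p x
  simpa [listInt, listEval] using h

/-- The coefficients of the first six shifted Legendre polynomials. -/
def legendreList : ℕ → List ℚ
  | 0 => [1]
  | 1 => [-1, 2]
  | 2 => [1, -6, 6]
  | 3 => [-1, 12, -30, 20]
  | 4 => [1, -20, 90, -140, 70]
  | 5 => [-1, 30, -210, 560, -630, 252]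
  | _ => []

/-- The iterated integral of Legendre polynomials belonging to a word. -/
def dysonList : List ℕ → List ℚ
  | [] => [1]
  | l :: w => listInt (listMul (legendreList l) (dysonList w))

/-- The iterated integral over the whole interval. -/
def dysonWord (w : List ℕ) : ℚ := (dysonList w).sum

/-- This reflects `P_l(1 - x) = (-1)^l P_l(x)`: reversing time inverts the propagator. Rational
coefficient lists make it a finite computation. -/
theorem dysonWord_alt_inverse :
    ∀ k ∈ [2, 4, 6], ∀ w ∈ words k, wordConv (alt dysonWord) dysonWord w = 0 := by
  decide +kernel

/-- In these weights a letter of degree at least 3 is integrated against a polynomial of smaller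
degree, so orthogonality kills the integral. -/
theorem dysonWord_eq_zero :
    ∀ k ∈ [1, 3, 5], ∀ w ∈ words k, (∃ l ∈ w, 3 ≤ l) → dysonWord w = 0 := by
  decide +kernel

/-! ### The series of a time-symmetric propagator with five exponentials -/

/-- A row of coefficients, extended by zero. -/
def rowCoeff (c : Fin 3 → ℝ) (l : ℕ) : ℝ := if h : l < 3 then c ⟨l, h⟩ else 0

/-- The series of a product of five exponentials. -/
noncomputable def propWord (f : Fin 5 → Fin 3 → ℝ) : List ℕ → ℝ :=
  wordConv (expWord (rowCoeff (f 0))) <| wordConv (expWord (rowCoeff (f 1))) <|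
    wordConv (expWord (rowCoeff (f 2))) <| wordConv (expWord (rowCoeff (f 3)))
      (expWord (rowCoeff (f 4)))

theorem propWord_shufflesLetters (f : Fin 5 → Fin 3 → ℝ) : ShufflesLetters (propWord f) :=
  (expWord_shufflesLetters _).wordConv <| (expWord_shufflesLetters _).wordConv <|
    (expWord_shufflesLetters _).wordConv <| (expWord_shufflesLetters _).wordConv
      (expWord_shufflesLetters _)

theorem expWord_eq_zero {c : ℕ → ℝ} {l : ℕ} (h : c l = 0) (w : List ℕ) (hw : l ∈ w) :
    expWord c w = 0 := by
  have : (w.map c).prod = 0 := List.prod_eq_zero (h ▸ List.mem_map_of_mem hw)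
  simp [expWord, this]

theorem propWord_eq_zero (f : Fin 5 → Fin 3 → ℝ) {l : ℕ} (hl : 3 ≤ l) (w : List ℕ)
    (hw : l ∈ w) : propWord f w = 0 := by
  have h : ∀ i w, l ∈ w → expWord (rowCoeff (f i)) w = 0 := fun i =>
    expWord_eq_zero (by simp [rowCoeff, hl.not_gt])
  exact wordConv_eq_zero_of_mem (h 0) (wordConv_eq_zero_of_mem (h 1)
    (wordConv_eq_zero_of_mem (h 2) (wordConv_eq_zero_of_mem (h 3) (h 4)))) w hw

/-- The letter `l` receives `(-1) ^ (l + 1)` from its weight and `(-1) ^ l` from the symmetry, which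
together leave the sign `-1`. -/
theorem alt_expWord {c d : ℕ → ℝ} (h : ∀ l, d l = (-1) ^ l * c l) :
    alt (expWord d) = expWord fun l => -c l := by
  funext w
  have key : (-1) ^ weight w * (w.map d).prod = (w.map fun l => -c l).prod := by
    induction w with
    | nil => simp
    | cons l w ih =>
      have h1 : ((-1 : ℝ) ^ l) * (-1) ^ l = 1 := by rw [← mul_pow]; simp
      simp only [weight_cons, List.map_cons, List.prod_cons, ← ih, h]
      linear_combination (-c l * (-1) ^ weight w * (w.map d).prod) * h1
  rw [alt, expWord, ← mul_div_assoc, key, expWord]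

/-- The product telescopes from the middle: the twisted factor of row 4 cancels that of row 0, then
row 3 cancels row 1, and so on. -/
theorem alt_propWord (f : Fin 5 → Fin 3 → ℝ) (hf : IsTimeSymmetric f) :
    wordConv (alt (propWord f)) (propWord f) = wordOne := by
  have h : ∀ i, wordConv (alt (expWord (rowCoeff (f i.rev)))) (expWord (rowCoeff (f i)))
      = wordOne := by
    intro i
    rw [alt_expWord (c := rowCoeff (f i)), wordConv_expWord_neg]
    intro l
    by_cases hl : l < 3
    · simpa [rowCoeff, hl] using hf i ⟨l, hl⟩
    · simp [rowCoeff, hl]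
  have h' : ∀ i T, wordConv (alt (expWord (rowCoeff (f i.rev))))
      (wordConv (expWord (rowCoeff (f i))) T) = T := by
    intro i T
    rw [← wordConv_assoc, h, wordConv_one_left]
  have h0 := h' 0
  have h1 := h' 1
  have h2 := h' 2
  have h3 := h' 3
  have h4 := h 4
  simp only [show Fin.rev (0 : Fin 5) = 4 from rfl, show Fin.rev (1 : Fin 5) = 3 from rfl,
    show Fin.rev (2 : Fin 5) = 2 from rfl, show Fin.rev (3 : Fin 5) = 1 from rfl,
    show Fin.rev (4 : Fin 5) = 0 from rfl] at h0 h1 h2 h3 h4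
  rw [propWord]
  simp only [alt_wordConv, wordConv_assoc]
  rw [h0, h1, h2, h3, h4]

section Lyndon

variable {f : Fin 5 → Fin 3 → ℝ}

/-- The order conditions concern Hall coefficients of the logarithm of the product, whereas these
are coefficients of the product itself; the two differ by products of lower Hall coefficients. -/
theorem propWord_lyndon (hf : IsTimeSymmetric f) (hc : SixthOrderConditions f) :
    propWord f [0] = 1 ∧ propWord f [1] = 0 ∧ propWord f [2] = 0 ∧ propWord f [0, 1] = -(1 / 6) ∧
    propWord f [1, 2] = -(1 / 30) ∧ propWord f [0, 0, 2] = 1 / 60 ∧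
    propWord f [0, 1, 1] = 1 / 60 ∧ propWord f [0, 0, 0, 1] = -(1 / 40) := by
  have h21 : f 2 1 = 0 := by
    have := hf 2 1
    rw [show Fin.rev (2 : Fin 5) = 2 from rfl] at this
    simp at this
    linarith
  have h3 : ∀ n, f 3 n = (-1) ^ (n : ℕ) * f 1 n := hf 1
  have h4 : ∀ n, f 4 n = (-1) ^ (n : ℕ) * f 0 n := hf 0
  obtain ⟨c1, c2, c3, c4, c5, c6, c7⟩ := hc
  have e0 : ∀ i, rowCoeff (f i) 0 = f i 0 := fun i => rfl
  have e1 : ∀ i, rowCoeff (f i) 1 = f i 1 := fun i => rfl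
  have e2 : ∀ i, rowCoeff (f i) 2 = f i 2 := fun i => rfl
  have ex : ∀ c w, expWord c w = (w.map c).prod / w.length.factorial := fun _ _ => rfl
  have g30 : f 3 0 = f 1 0 := by simp [h3]
  have g31 : f 3 1 = -f 1 1 := by simp [h3]
  have g32 : f 3 2 = f 1 2 := by simp [h3]
  have g40 : f 4 0 = f 0 0 := by simp [h4]
  have g41 : f 4 1 = -f 0 1 := by simp [h4]
  have g42 : f 4 2 = f 0 2 := by simp [h4]
  have v0 : propWord f [0] = 1 := by
    simp [propWord, wordConv, ex, e0, g30, g40]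
    linear_combination -c1
  have v2 : propWord f [2] = 0 := by
    simp [propWord, wordConv, ex, e2, g32, g42]
    linear_combination -c2
  have v01 : propWord f [0, 1] = -(1 / 6) := by
    simp [propWord, wordConv, ex, e0, e1, g30, g40, g31, g41, h21]
    linear_combination -c3
  refine ⟨v0, ?_, v2, v01, ?_, ?_, ?_, ?_⟩
  · simp [propWord, wordConv, ex, e1, g31, g41, h21]
  · simp [propWord, wordConv, ex, e1, e2, g31, g41, g32, g42, h21]
    linear_combination -c4
  -- The cubic term of the exponential series adds `φ₀² φ₂ / 6` to the logarithm's coefficient, `φ`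
  -- denoting coefficients of the logarithm.
  · have : propWord f [0, 0, 2] = 1 / 60 + propWord f [0] ^ 2 * propWord f [2] / 6 := by
      simp [propWord, wordConv, ex, e0, e2, g30, g40, g32, g42, Nat.factorial]
      linear_combination -c5
    rw [this, v2]
    norm_num
  · simp [propWord, wordConv, ex, e0, e1, g30, g40, g31, g41, h21, Nat.factorial]
    linear_combination c6
  -- Here the correction is `φ₀² φ₀₁ / 6 = -1/36`, whence `1/360 - 1/36 = -1/40`.
  · have : propWord f [0, 0, 0, 1] = 1 / 360 + propWord f [0] ^ 2 * propWord f [0, 1] / 6 := by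
      simp [propWord, wordConv, ex, e0, e1, g30, g40, g31, g41, h21, Nat.factorial]
      linear_combination -c7
    rw [this, v0, v01]
    norm_num

end Lyndon

theorem propWord_eq_dysonWord {f : Fin 5 → Fin 3 → ℝ} (hf : IsTimeSymmetric f)
    (hc : SixthOrderConditions f) (w : List ℕ) (hw : weight w ≤ 6) :
    propWord f w = dysonWord w := by
  have hs := propWord_shufflesLetters f
  have hdw : ∀ w, wordConv (alt fun v => (dysonWord v : ℝ)) (fun v => (dysonWord v : ℝ)) w
      = (wordConv (alt dysonWord) dysonWord w : ℚ) := by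
    intro w
    simp only [wordConv_eq_sum, alt]
    push_cast
    rfl
  have heven : ∀ k, Even k → k ∈ [2, 4, 6] →
      (∀ v, weight v < k → propWord f v = dysonWord v) →
      ∀ w, weight w = k → propWord f w = dysonWord w := by
    intro k hk hk' ih w hw
    have hne : w ≠ [] := by
      rintro rfl
      rw [weight_nil] at hw
      subst hw
      simp at hk'
    refine eq_of_alt_inverse (T := fun v => (dysonWord v : ℝ)) hne (hw ▸ hk) hs.1
      (by simp [dysonWord, dysonList]) ?_ ?_ (hw ▸ ih)
    · rw [alt_propWord f hf]
      cases w with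
      | nil => exact absurd rfl hne
      | cons l w => rfl
    · rw [hdw, dysonWord_alt_inverse k hk' w (hw ▸ mem_words_weight w), Rat.cast_zero]
  have hbig : ∀ k ∈ [1, 3, 5], (∀ w ∈ words k, (∀ l ∈ w, l < 3) → propWord f w = dysonWord w) →
      ∀ w, weight w = k → propWord f w = dysonWord w := by
    intro k hk h w hw
    have hmem := hw ▸ mem_words_weight w
    by_cases hl : ∀ l ∈ w, l < 3
    · exact h w hmem hl
    · push Not at hl
      obtain ⟨l, hlw, hl⟩ := hl
      rw [propWord_eq_zero f hl w hlw, dysonWord_eq_zero k hk w hmem ⟨l, hlw, hl⟩, Rat.cast_zero]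
  obtain ⟨v0, v1, v2, v01, v12, v002, v011, v0001⟩ := propWord_lyndon hf hc
  have ins := hs.2
  have w0 : ∀ v, weight v = 0 → propWord f v = dysonWord v := by
    intro v hv
    cases v with
    | nil => simp [hs.1, dysonWord, dysonList]
    | cons l v => simp at hv
  have w1 : ∀ v, weight v = 1 → propWord f v = dysonWord v :=
    hbig 1 (by simp) (by
      have u0 : dysonWord [0] = 1 := by decide +kernel
      simp [words, v0, u0])
  have w2 := heven 2 (by decide) (by simp) fun v hv => by
    interval_cases h : weight v
    exacts [w0 v h, w1 v h]
  have s00 := ins 0 [0]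
  have s000 := ins 0 [0, 0]
  have s10 := ins 1 [0]
  simp only [insertSum, v0, v1] at s00 s000 s10
  have w3 : ∀ v, weight v = 3 → propWord f v = dysonWord v :=
    hbig 3 (by simp) (by
      have u000 : dysonWord [0, 0, 0] = 1 / 6 := by decide +kernel
      have u01 : dysonWord [0, 1] = -(1 / 6) := by decide +kernel
      have u10 : dysonWord [1, 0] = 1 / 6 := by decide +kernel
      have u2 : dysonWord [2] = 0 := by decide +kernel
      simp [words, v2, v01, u2, u01, u10, u000]
      constructor <;> linarith)
  have w4 := heven 4 (by decide) (by simp) fun v hv => by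
    interval_cases h : weight v
    exacts [w0 v h, w1 v h, w2 v h, w3 v h]
  have w5 : ∀ v, weight v = 5 → propWord f v = dysonWord v :=
    hbig 5 (by simp) (by
      -- Thirteen words of weight 5 use only letters below 3. Four are the Lyndon words already
      -- known; the nine relations `r21`, …, `r00000`, fed with the values in weight at most 4,
      -- determine the other nine.
      have d : ∀ p ∈ ([([0, 2], 0), ([2, 0], 0), ([0, 0, 1], -(1 / 12)), ([0, 1, 0], 0),
          ([1, 0, 0], 1 / 12), ([0, 0, 0, 0], 1 / 24), ([0, 0, 0, 0, 0], 1 / 120),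
          ([0, 0, 0, 1], -(1 / 40)), ([0, 0, 1, 0], -(1 / 120)), ([0, 1, 0, 0], 1 / 120),
          ([1, 0, 0, 0], 1 / 40), ([0, 0, 2], 1 / 60), ([0, 2, 0], -(1 / 30)),
          ([2, 0, 0], 1 / 60), ([0, 1, 1], 1 / 60), ([1, 0, 1], -(1 / 30)), ([1, 1, 0], 1 / 60),
          ([1, 2], -(1 / 30)), ([2, 1], 1 / 30)] : List (List ℕ × ℚ)), dysonWord p.1 = p.2 := by
        decide +kernel
      simp only [List.forall_mem_cons, List.not_mem_nil, false_imp_iff, implies_true,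
        and_true] at d
      obtain ⟨d02, d20, d001, d010, d100, d0000, d00000, d0001, d0010, d0100, d1000, d002, d020,
        d200, d011, d101, d110, d12, d21⟩ := d
      have p02 := w4 [0, 2] rfl
      have p20 := w4 [2, 0] rfl
      have p001 := w4 [0, 0, 1] rfl
      have p010 := w4 [0, 1, 0] rfl
      have p100 := w4 [1, 0, 0] rfl
      have p0000 := w4 [0, 0, 0, 0] rfl
      have r21 := ins 2 [1]
      have r020 := ins 0 [0, 2]
      have r200 := ins 0 [2, 0]
      have r101 := ins 1 [0, 1]
      have r110 := ins 1 [1, 0]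
      have r0010 := ins 0 [0, 0, 1]
      have r0100 := ins 0 [0, 1, 0]
      have r1000 := ins 0 [1, 0, 0]
      have r00000 := ins 0 [0, 0, 0, 0]
      simp only [insertSum, v0, v1, v2, p02, p20, p001, p010, p100, p0000, d02, d20, d001, d010,
        d100, d0000] at r21 r020 r200 r101 r110 r0010 r0100 r1000 r00000
      push_cast at r21 r020 r200 r101 r110 r0010 r0100 r1000 r00000
      simp [words, d00000, d0001, d0010, d0100, d1000, d002, d020, d200, d011, d101, d110, d12,
        d21, v002, v011, v0001, v12]
      refine ⟨?_, ?_, ?_, ?_, ?_, ?_, ?_, ?_, ?_⟩ <;> linarith)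
  have w6 := heven 6 (by decide) (by simp) fun v hv => by
    interval_cases h : weight v
    exacts [w0 v h, w1 v h, w2 v h, w3 v h, w4 v h, w5 v h]
  interval_cases h : weight w
  exacts [w0 w h, w1 w h, w2 w h, w3 w h, w4 w h, w5 w h, w6 w h]

/-! ### Homogeneous parts of evaluated series -/

section HomPart

variable {𝔸 : Type u} [NormedRing 𝔸] [NormedAlgebra ℝ 𝔸]

/-- The part of weight `k` of the value of a series at the elements `a l`. -/
noncomputable def homPart (a : ℕ → 𝔸) (S : List ℕ → ℝ) : ℕ → 𝔸
  | 0 => S [] • 1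
  | k + 1 => ∑ l : Fin (k + 1), a l * homPart a (fun v => S ((l : ℕ) :: v)) (k - l)
termination_by k => k
decreasing_by omega

theorem homPart_zero (a : ℕ → 𝔸) (S : List ℕ → ℝ) : homPart a S 0 = S [] • 1 := by
  rw [homPart]

theorem homPart_succ (a : ℕ → 𝔸) (S : List ℕ → ℝ) (k : ℕ) :
    homPart a S (k + 1)
      = ∑ l ∈ Finset.range (k + 1), a l * homPart a (fun v => S (l :: v)) (k - l) := by
  rw [homPart, Finset.sum_range fun l => a l * homPart a (fun v => S (l :: v)) (k - l)]

theorem homPart_congr (a : ℕ → 𝔸) {S T : List ℕ → ℝ} {k : ℕ}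
    (h : ∀ w, weight w = k → S w = T w) : homPart a S k = homPart a T k := by
  induction k using Nat.strong_induction_on generalizing S T with
  | _ k ih =>
    cases k with
    | zero => rw [homPart_zero, homPart_zero, h [] rfl]
    | succ k =>
      rw [homPart_succ, homPart_succ]
      refine Finset.sum_congr rfl fun l hl => ?_
      have := Finset.mem_range.1 hl
      rw [ih (k - l) (by omega) fun w hw => h _ (by simp; omega)]

theorem homPart_add (a : ℕ → 𝔸) (S T : List ℕ → ℝ) (k : ℕ) :
    homPart a (fun w => S w + T w) k = homPart a S k + homPart a T k := by
  induction k using Nat.strong_induction_on generalizing S T with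
  | _ k ih =>
    cases k with
    | zero => simp only [homPart_zero, add_smul]
    | succ k =>
      simp only [homPart_succ, ← Finset.sum_add_distrib]
      refine Finset.sum_congr rfl fun l hl => ?_
      have := Finset.mem_range.1 hl
      rw [ih (k - l) (by omega), mul_add]

theorem homPart_smul (a : ℕ → 𝔸) (c : ℝ) (S : List ℕ → ℝ) (k : ℕ) :
    homPart a (fun w => c * S w) k = c • homPart a S k := by
  induction k using Nat.strong_induction_on generalizing S with
  | _ k ih =>
    cases k with
    | zero => simp only [homPart_zero, mul_smul]
    | succ k =>
      simp only [homPart_succ, Finset.smul_sum]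
      refine Finset.sum_congr rfl fun l hl => ?_
      have := Finset.mem_range.1 hl
      rw [ih (k - l) (by omega), mul_smul_comm]

/-- Evaluation of words is multiplicative and additive in weight, so concatenation of series becomes
the Cauchy product of homogeneous parts. -/
theorem homPart_wordConv (a : ℕ → 𝔸) (S T : List ℕ → ℝ) (k : ℕ) :
    homPart a (wordConv S T) k
      = ∑ i ∈ Finset.range (k + 1), homPart a S i * homPart a T (k - i) := by
  induction k using Nat.strong_induction_on generalizing S with
  | _ k ih =>
    cases k with
    | zero => simp [homPart_zero, wordConv, mul_smul, smul_comm (T [])]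
    | succ k =>
      rw [Finset.sum_range_succ' _ (k + 1), homPart_succ, homPart_zero]
      have h1 : ∀ l ∈ Finset.range (k + 1),
          a l * homPart a (fun v => wordConv S T (l :: v)) (k - l)
            = S [] • (a l * homPart a (fun v => T (l :: v)) (k - l))
              + ∑ i ∈ Finset.range (k - l + 1),
                a l * (homPart a (fun v => S (l :: v)) i * homPart a T (k - l - i)) := by
        intro l hl
        have := Finset.mem_range.1 hl
        simp only [wordConv]
        rw [homPart_add, homPart_smul, ih (k - l) (by omega), mul_add, mul_smul_comm,
          Finset.mul_sum]
      have h2 : ∀ i ∈ Finset.range (k + 1),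
          homPart a S (i + 1) * homPart a T (k + 1 - (i + 1))
            = ∑ l ∈ Finset.range (i + 1),
              a l * (homPart a (fun v => S (l :: v)) (i - l) * homPart a T (k - i)) := by
        intro i _
        rw [homPart_succ, Finset.sum_mul, Nat.add_sub_add_right]
        exact Finset.sum_congr rfl fun l _ => mul_assoc _ _ _
      rw [Finset.sum_congr rfl h1, Finset.sum_congr rfl h2, Finset.sum_add_distrib,
        ← Finset.smul_sum, ← homPart_succ, add_comm, smul_one_mul, Nat.sub_zero]
      congr 1
      rw [Finset.sum_sigma', Finset.sum_sigma']
      -- The pair of first letter `l` and weight `i` of the rest of the left factor is reindexed by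
      -- `l + i`, one less than the weight of the left factor, and `l`.
      refine Finset.sum_bij' (fun p _ => ⟨p.1 + p.2, p.1⟩) (fun p _ => ⟨p.2, p.1 - p.2⟩)
        ?_ ?_ ?_ ?_ ?_
      · rintro ⟨l, i⟩ h
        simp at h ⊢
        omega
      · rintro ⟨i, l⟩ h
        simp at h ⊢
        omega
      · rintro ⟨l, i⟩ h
        simp
      · rintro ⟨i, l⟩ h
        simp at h ⊢
        omega
      · rintro ⟨l, i⟩ h
        simp only [Nat.add_sub_cancel_left, Nat.sub_sub]

/-- Homogeneous parts of weight `k` are of the order `h ^ k`, uniformly in parameters. -/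
theorem exists_homPart_bound {S : ℝ → List ℕ → ℝ} (hS : ∀ w, Continuous fun x => S x w)
    {M : ℝ} (hM : 0 ≤ M) (k : ℕ) :
    ∃ C, 0 ≤ C ∧ ∀ h : ℝ, 0 ≤ h → ∀ a : ℕ → 𝔸, (∀ l, ‖a l‖ ≤ M * h ^ (l + 1)) →
      ∀ x ∈ Icc (0 : ℝ) 1, ‖homPart a (S x) k‖ ≤ C * h ^ k := by
  induction k using Nat.strong_induction_on generalizing S with
  | _ k ih =>
    cases k with
    | zero =>
      obtain ⟨C, hC⟩ := isCompact_Icc.exists_bound_of_continuousOn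
        (hS []).continuousOn (s := Icc (0 : ℝ) 1)
      refine ⟨C * ‖(1 : 𝔸)‖, mul_nonneg ((norm_nonneg _).trans (hC 0 (by simp))) (norm_nonneg _),
        fun h _ a _ x hx => ?_⟩
      rw [homPart_zero, norm_smul, pow_zero, mul_one]
      exact mul_le_mul_of_nonneg_right (hC x hx) (norm_nonneg _)
    | succ k =>
      have h1 : ∀ l, ∃ C, 0 ≤ C ∧ (l ∈ Finset.range (k + 1) → ∀ h : ℝ, 0 ≤ h → ∀ a : ℕ → 𝔸,
          (∀ l, ‖a l‖ ≤ M * h ^ (l + 1)) → ∀ x ∈ Icc (0 : ℝ) 1,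
          ‖homPart a (fun v => S x (l :: v)) (k - l)‖ ≤ C * h ^ (k - l)) := by
        intro l
        by_cases hl : l ∈ Finset.range (k + 1)
        · have := Finset.mem_range.1 hl
          obtain ⟨C, hC, h⟩ := ih (k - l) (by omega) (S := fun x v => S x (l :: v))
            fun w => hS (l :: w)
          exact ⟨C, hC, fun _ => h⟩
        · exact ⟨0, le_rfl, fun h => absurd h hl⟩
      choose C hC hb using h1
      refine ⟨∑ l ∈ Finset.range (k + 1), M * C l,
        Finset.sum_nonneg fun l _ => mul_nonneg hM (hC l), fun h hh a ha x hx => ?_⟩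
      rw [homPart_succ, Finset.sum_mul]
      refine norm_sum_le_of_le _ fun l hl => (norm_mul_le _ _).trans ?_
      have := Finset.mem_range.1 hl
      calc ‖a l‖ * ‖homPart a (fun v => S x (l :: v)) (k - l)‖
          ≤ (M * h ^ (l + 1)) * (C l * h ^ (k - l)) :=
            mul_le_mul (ha l) (hb l hl h hh a ha x hx) (norm_nonneg _) (by positivity)
        _ = M * C l * h ^ (k + 1) := by
            rw [show k + 1 = (l + 1) + (k - l) by omega, pow_add]; ring

/-! ### Expansions up to weight six -/

/-- `F` agrees up to `O(h ^ (p + 1))` with the terms of weight at most `p` of the series `S`. -/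
def HasWordExpansion (p : ℕ) (a : ℝ → ℕ → 𝔸) (F : ℝ → 𝔸) (S : List ℕ → ℝ) : Prop :=
  (fun h => F h - ∑ k ∈ Finset.range (p + 1), homPart (a h) S k)
    =O[𝓝[>] 0] fun h : ℝ => h ^ (p + 1)

theorem pow_isBigO_pow {m n : ℕ} (hmn : m ≤ n) :
    (fun h : ℝ => h ^ n) =O[𝓝[>] 0] fun h : ℝ => h ^ m := by
  refine IsBigO.of_bound 1 ?_
  filter_upwards [Ioo_mem_nhdsGT (zero_lt_one' ℝ)] with h hh
  rw [one_mul, norm_pow, norm_pow]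
  exact pow_le_pow_of_le_one (norm_nonneg _)
    (by rw [Real.norm_eq_abs, abs_of_pos hh.1]; exact hh.2.le) hmn

theorem isBigO_homPart {a : ℝ → ℕ → 𝔸} {M : ℝ}
    (ha : ∀ᶠ h in 𝓝[>] (0 : ℝ), ∀ l, ‖a h l‖ ≤ M * h ^ (l + 1)) (S : List ℕ → ℝ) (k : ℕ) :
    (fun h => homPart (a h) S k) =O[𝓝[>] 0] fun h : ℝ => h ^ k := by
  have hM : 0 ≤ max M 0 := le_max_right _ _
  obtain ⟨C, hC, hb⟩ := exists_homPart_bound (𝔸 := 𝔸) (S := fun _ => S)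
    (fun w => continuous_const) hM k
  refine IsBigO.of_bound C ?_
  filter_upwards [ha, self_mem_nhdsWithin] with h h1 h2
  have h0 : 0 ≤ h := le_of_lt h2
  rw [norm_pow, Real.norm_eq_abs, abs_of_nonneg h0]
  refine hb h h0 _ (fun l => (h1 l).trans ?_) 0 (by simp)
  exact mul_le_mul_of_nonneg_right (le_max_left _ _) (by positivity)

/-- With truncations `PS`, `PT`, the error is `(F - PS) G + PS (G - PT)` plus the terms of `PS PT`
of weight above `p`, each of order `h ^ (p + 1)`. -/
theorem HasWordExpansion.mul {p : ℕ} {a : ℝ → ℕ → 𝔸} {M : ℝ}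
    (ha : ∀ᶠ h in 𝓝[>] (0 : ℝ), ∀ l, ‖a h l‖ ≤ M * h ^ (l + 1)) {F G : ℝ → 𝔸}
    {S T : List ℕ → ℝ} (hF : HasWordExpansion p a F S) (hG : HasWordExpansion p a G T) :
    HasWordExpansion p a (fun h => F h * G h) (wordConv S T) := by
  set PS := fun h => ∑ k ∈ Finset.range (p + 1), homPart (a h) S k
  set PT := fun h => ∑ k ∈ Finset.range (p + 1), homPart (a h) T k
  have hsum : ∀ S, (fun h => ∑ k ∈ Finset.range (p + 1), homPart (a h) S k)
      =O[𝓝[>] 0] fun _ : ℝ => (1 : ℝ) := fun S =>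
    IsBigO.fun_sum fun k _ => (isBigO_homPart ha S k).trans
      (by simpa only [pow_zero] using pow_isBigO_pow (Nat.zero_le k))
  have hone : (fun h : ℝ => h ^ (p + 1)) =O[𝓝[>] 0] fun _ : ℝ => (1 : ℝ) := by
    simpa only [pow_zero] using pow_isBigO_pow (Nat.zero_le (p + 1))
  have hG1 : G =O[𝓝[>] 0] fun _ : ℝ => (1 : ℝ) := by
    have := (hG.trans hone).add (hsum T)
    simpa using this
  have h1 : (fun h => (F h - PS h) * G h) =O[𝓝[>] 0] fun h : ℝ => h ^ (p + 1) := by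
    simpa using IsBigO.mul hF hG1
  have h2 : (fun h => PS h * (G h - PT h)) =O[𝓝[>] 0] fun h : ℝ => h ^ (p + 1) := by
    simpa using IsBigO.mul (hsum S) hG
  have h3 : (fun h => PS h * PT h - ∑ k ∈ Finset.range (p + 1), homPart (a h) (wordConv S T) k)
      =O[𝓝[>] 0] fun h : ℝ => h ^ (p + 1) := by
    have heq : ∀ h, PS h * PT h - ∑ k ∈ Finset.range (p + 1), homPart (a h) (wordConv S T) k
        = ∑ i ∈ Finset.range (p + 1), ∑ j ∈ Finset.Ico (p + 1 - i) (p + 1),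
            homPart (a h) S i * homPart (a h) T j := by
      intro h
      have hsplit : ∀ i ∈ Finset.range (p + 1),
          ∑ j ∈ Finset.range (p + 1), homPart (a h) S i * homPart (a h) T j
            = ∑ j ∈ Finset.range (p + 1 - i), homPart (a h) S i * homPart (a h) T j
              + ∑ j ∈ Finset.Ico (p + 1 - i) (p + 1), homPart (a h) S i * homPart (a h) T j :=
        fun i _ => (Finset.sum_range_add_sum_Ico _ (Nat.sub_le _ _)).symm
      have htri : ∑ k ∈ Finset.range (p + 1), homPart (a h) (wordConv S T) k
          = ∑ i ∈ Finset.range (p + 1), ∑ j ∈ Finset.range (p + 1 - i),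
            homPart (a h) S i * homPart (a h) T j := by
        simp only [homPart_wordConv]
        exact Finset.sum_range_diag_flip (p + 1) fun i j => homPart (a h) S i * homPart (a h) T j
      rw [Finset.sum_mul_sum, Finset.sum_congr rfl hsplit, Finset.sum_add_distrib, htri,
        add_sub_cancel_left]
    simp only [heq]
    refine IsBigO.fun_sum fun i hi => IsBigO.fun_sum fun j hj => ?_
    have := Finset.mem_Ico.1 hj
    refine ((isBigO_homPart ha S i).mul (isBigO_homPart ha T j)).trans ?_
    simp only [← pow_add]
    exact pow_isBigO_pow (by omega)
  refine ((h1.add h2).add h3).congr_left fun h => ?_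
  noncomm_ring

end HomPart

/-! ### Expansion of solutions of linear differential equations -/

section ODE

variable {𝔸 : Type u} [NormedRing 𝔸] [NormedAlgebra ℝ 𝔸]

theorem hasDerivAt_homPart (a : ℕ → 𝔸) {S : ℝ → List ℕ → ℝ} {S' : List ℕ → ℝ} {x : ℝ}
    (h : ∀ w, HasDerivAt (fun y => S y w) (S' w) x) (k : ℕ) :
    HasDerivAt (fun y => homPart a (S y) k) (homPart a S' k) x := by
  induction k using Nat.strong_induction_on generalizing S S' with
  | _ k ih =>
    cases k with
    | zero =>
      simp only [homPart_zero]
      exact (h []).smul_const 1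
    | succ k =>
      simp only [homPart_succ]
      refine HasDerivAt.fun_sum fun l hl => ?_
      have := Finset.mem_range.1 hl
      exact (ih (k - l) (by omega) fun w => h (l :: w)).const_mul (a l)

theorem homPart_zero_series (a : ℕ → 𝔸) (k : ℕ) : homPart a (fun _ => 0) k = 0 := by
  simpa using homPart_smul a 0 (fun _ => 0) k

/-- The series `D` consists of the iterated integrals of the functions `q`. -/
structure IsIteratedIntegral (q : ℕ → ℝ → ℝ) (D : ℝ → List ℕ → ℝ) : Prop where
  nil : ∀ x, D x [] = 1
  zero : ∀ l w, D 0 (l :: w) = 0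
  deriv : ∀ l w x, HasDerivAt (fun y => D y (l :: w)) (q l x * D x w) x

variable {q : ℕ → ℝ → ℝ} {D : ℝ → List ℕ → ℝ}

theorem IsIteratedIntegral.continuous (hD : IsIteratedIntegral q D) (w : List ℕ) :
    Continuous fun x => D x w := by
  cases w with
  | nil => simpa only [hD.nil] using continuous_const
  | cons l w => exact continuous_iff_continuousAt.2 fun x => (hD.deriv l w x).continuousAt

theorem IsIteratedIntegral.sum_homPart_zero (hD : IsIteratedIntegral q D) (a : ℕ → 𝔸) (p : ℕ) :
    ∑ k ∈ Finset.range (p + 1), homPart a (D 0) k = 1 := by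
  rw [Finset.sum_range_succ', homPart_zero, hD.nil, one_smul, Finset.sum_eq_zero, zero_add]
  intro k _
  rw [← homPart_zero_series a (k + 1)]
  refine homPart_congr a fun w hw => ?_
  cases w with
  | nil => simp at hw
  | cons l w => exact hD.zero l w

/-- Differentiation strips the first letter. The result is the product of the letter sum with the
truncated series, restricted to weights `l + 1 + k ≤ p`. -/
theorem IsIteratedIntegral.hasDerivAt_sum_homPart (hD : IsIteratedIntegral q D) (a : ℕ → 𝔸)
    (p : ℕ) (x : ℝ) :
    HasDerivAt (fun y => ∑ k ∈ Finset.range (p + 1), homPart a (D y) k)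
      (∑ l ∈ Finset.range p, ∑ k ∈ Finset.range (p - l),
        (q l x • a l) * homPart a (D x) k) x := by
  let D' : List ℕ → ℝ := fun w =>
    match w with
    | [] => 0
    | l :: w => q l x * D x w
  have hD' : ∀ w, HasDerivAt (fun y => D y w) (D' w) x := by
    intro w
    cases w with
    | nil => simpa only [hD.nil] using hasDerivAt_const x (1 : ℝ)
    | cons l w => exact hD.deriv l w x
  refine (HasDerivAt.fun_sum fun k (_ : k ∈ Finset.range (p + 1)) =>
    hasDerivAt_homPart a hD' k).congr_deriv ?_
  rw [Finset.sum_range_succ', homPart_zero, show D' [] = 0 from rfl, zero_smul, add_zero,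
    ← Finset.sum_range_diag_flip p fun l k => (q l x • a l) * homPart a (D x) k]
  refine Finset.sum_congr rfl fun k _ => ?_
  rw [homPart_succ]
  refine Finset.sum_congr rfl fun l _ => ?_
  change a l * homPart a (fun v => q l x * D x v) (k - l) = _
  rw [homPart_smul, mul_smul_comm, smul_mul_assoc]

/-- The truncated series `Z` solves the same equation up to the product terms of weight above `p`
and the error in `B`. This defect is `O(h ^ (p + 1))` uniformly on `[0, 1]`, and Gronwall's
inequality transfers the bound to `Y - Z`. -/
theorem IsIteratedIntegral.hasWordExpansion (hD : IsIteratedIntegral q D)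
    (hq : ∀ l, Continuous (q l)) (p : ℕ) {a : ℝ → ℕ → 𝔸} {M : ℝ}
    (ha : ∀ᶠ h in 𝓝[>] (0 : ℝ), ∀ l, ‖a h l‖ ≤ M * h ^ (l + 1)) {Y B : ℝ → ℝ → 𝔸}
    (hY0 : ∀ᶠ h in 𝓝[>] (0 : ℝ), Y h 0 = 1)
    (hY : ∀ᶠ h in 𝓝[>] (0 : ℝ), ∀ x ∈ Icc (0 : ℝ) 1,
      HasDerivWithinAt (Y h) (B h x * Y h x) (Icc 0 1) x)
    (hB : ∀ᶠ h in 𝓝[>] (0 : ℝ), ∀ x ∈ Icc (0 : ℝ) 1,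
      ‖B h x - ∑ l ∈ Finset.range p, q l x • a h l‖ ≤ M * h ^ (p + 1)) :
    HasWordExpansion p a (fun h => Y h 1) (D 1) := by
  have hM : 0 ≤ M := by
    obtain ⟨h, h1, h2⟩ := (ha.and self_mem_nhdsWithin).exists
    have h3 := (norm_nonneg _).trans (h1 0)
    have h4 : (0 : ℝ) < h := h2
    simp only [zero_add, pow_one] at h3
    exact nonneg_of_mul_nonneg_left h3 h4
  choose Q hQ using fun l => isCompact_Icc.exists_bound_of_continuousOn
    (hq l).continuousOn (s := Icc (0 : ℝ) 1)
  have hQ0 : ∀ l, 0 ≤ Q l := fun l => (norm_nonneg _).trans (hQ l 0 (by simp))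
  choose C hC0 hC using exists_homPart_bound (𝔸 := 𝔸) hD.continuous hM
  -- `K` bounds `‖B h x‖` for `h < 1`; the extra `1` makes it positive, as the closed form of the
  -- Gronwall bound divides by `K`. `E` collects the defect constants.
  set K := M + ∑ l ∈ Finset.range p, Q l * M + 1 with hK
  set E := M * ∑ k ∈ Finset.range (p + 1), C k
    + ∑ l ∈ Finset.range p, ∑ k ∈ Finset.Ico (p - l) (p + 1), Q l * M * C k with hE
  have hs1 : 0 ≤ ∑ l ∈ Finset.range p, Q l * M :=
    Finset.sum_nonneg fun l _ => mul_nonneg (hQ0 l) hM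
  have hKpos : 0 < K := by positivity
  refine IsBigO.of_bound (E / K * (Real.exp K - 1)) ?_
  filter_upwards [ha, hY0, hY, hB, Ioo_mem_nhdsGT (zero_lt_one' ℝ)] with h ha hY0 hY hB hh
  have h0 : 0 ≤ h := hh.1.le
  have hpow : ∀ n, h ^ n ≤ 1 := fun n => pow_le_one₀ h0 hh.2.le
  set Z : ℝ → 𝔸 := fun x => ∑ k ∈ Finset.range (p + 1), homPart (a h) (D x) k with hZ
  set P : ℝ → 𝔸 := fun x => ∑ l ∈ Finset.range p, q l x • a h l with hP
  set Z' : ℝ → 𝔸 := fun x => ∑ l ∈ Finset.range p, ∑ k ∈ Finset.range (p - l),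
    (q l x • a h l) * homPart (a h) (D x) k with hZ'
  have hdZ : ∀ x, HasDerivAt Z (Z' x) x := hD.hasDerivAt_sum_homPart (a h) p
  have hletter : ∀ x ∈ Icc (0 : ℝ) 1, ∀ l, ‖q l x • a h l‖ ≤ Q l * M * h ^ (l + 1) := by
    intro x hx l
    rw [norm_smul, mul_assoc]
    exact mul_le_mul (hQ l x hx) (ha l) (norm_nonneg _) (hQ0 l)
  have hPn : ∀ x ∈ Icc (0 : ℝ) 1, ‖P x‖ ≤ ∑ l ∈ Finset.range p, Q l * M := fun x hx =>
    norm_sum_le_of_le _ fun l _ => (hletter x hx l).trans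
      (mul_le_of_le_one_right (mul_nonneg (hQ0 l) hM) (hpow _))
  have hZn : ∀ x ∈ Icc (0 : ℝ) 1, ‖Z x‖ ≤ ∑ k ∈ Finset.range (p + 1), C k := fun x hx =>
    norm_sum_le_of_le _ fun k _ => (hC k h h0 (a h) ha x hx).trans
      (mul_le_of_le_one_right (hC0 k) (hpow _))
  have hdefect : ∀ x ∈ Icc (0 : ℝ) 1, ‖P x * Z x - Z' x‖
      ≤ (∑ l ∈ Finset.range p, ∑ k ∈ Finset.Ico (p - l) (p + 1), Q l * M * C k)
        * h ^ (p + 1) := by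
    intro x hx
    have heq : P x * Z x - Z' x = ∑ l ∈ Finset.range p, ∑ k ∈ Finset.Ico (p - l) (p + 1),
        (q l x • a h l) * homPart (a h) (D x) k := by
      rw [hP, hZ, hZ', Finset.sum_mul_sum, ← Finset.sum_sub_distrib]
      refine Finset.sum_congr rfl fun l _ => ?_
      rw [sub_eq_iff_eq_add', Finset.sum_range_add_sum_Ico _ (by omega)]
    rw [heq, Finset.sum_mul]
    refine norm_sum_le_of_le _ fun l hl => ?_
    rw [Finset.sum_mul]
    refine norm_sum_le_of_le _ fun k hk => (norm_mul_le _ _).trans ?_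
    have hk' := Finset.mem_Ico.1 hk
    have hl' := Finset.mem_range.1 hl
    calc ‖q l x • a h l‖ * ‖homPart (a h) (D x) k‖
        ≤ (Q l * M * h ^ (l + 1)) * (C k * h ^ k) :=
          mul_le_mul (hletter x hx l) (hC k h h0 (a h) ha x hx) (norm_nonneg _)
            (mul_nonneg (mul_nonneg (hQ0 l) hM) (by positivity))
      _ = Q l * M * C k * h ^ (l + 1 + k) := by rw [pow_add]; ring
      _ ≤ Q l * M * C k * h ^ (p + 1) :=
          mul_le_mul_of_nonneg_left (pow_le_pow_of_le_one h0 hh.2.le (by omega))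
            (mul_nonneg (mul_nonneg (hQ0 l) hM) (hC0 k))
  have hBn : ∀ x ∈ Icc (0 : ℝ) 1, ‖B h x‖ ≤ K := by
    intro x hx
    have h1 := norm_add_le (B h x - P x) (P x)
    rw [sub_add_cancel] at h1
    have h2 := hB x hx
    have h3 := mul_le_of_le_one_right hM (hpow (p + 1))
    have h4 := hPn x hx
    linarith
  have hcont : ContinuousOn (fun x => Y h x - Z x) (Icc 0 1) := fun x hx =>
    ((hY x hx).sub (hdZ x).hasDerivWithinAt).continuousWithinAt
  have hderiv : ∀ x ∈ Ico (0 : ℝ) 1, HasDerivWithinAt (fun x => Y h x - Z x)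
      (B h x * Y h x - Z' x) (Ici x) x := fun x hx =>
    ((hY x (Ico_subset_Icc_self hx)).sub (hdZ x).hasDerivWithinAt).mono_of_mem_nhdsWithin
      (Icc_mem_nhdsGE_of_mem hx)
  have hgr := norm_le_gronwallBound_of_norm_deriv_right_le (δ := 0) (K := K)
    (ε := E * h ^ (p + 1)) hcont hderiv
    (by simp only [hZ, hY0, hD.sum_homPart_zero, sub_self, norm_zero, le_refl]) (by
      intro x hx
      have hx := Ico_subset_Icc_self hx
      have heq : B h x * Y h x - Z' x
          = B h x * (Y h x - Z x) + (B h x - P x) * Z x + (P x * Z x - Z' x) := by noncomm_ring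
      rw [heq]
      refine norm_add₃_le.trans ?_
      have h1 : ‖B h x * (Y h x - Z x)‖ ≤ K * ‖Y h x - Z x‖ :=
        (norm_mul_le _ _).trans (mul_le_mul_of_nonneg_right (hBn x hx) (norm_nonneg _))
      have h2 : ‖(B h x - P x) * Z x‖ ≤ M * h ^ (p + 1) * ∑ k ∈ Finset.range (p + 1), C k :=
        (norm_mul_le _ _).trans
          (mul_le_mul (hB x hx) (hZn x hx) (norm_nonneg _) (by positivity))
      have h3 := hdefect x hx
      rw [hE, add_mul]
      linarith) 1 (by simp)
  rw [gronwallBound_of_K_ne_0 hKpos.ne'] at hgr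
  simp only [sub_zero, mul_one, zero_mul, zero_add] at hgr
  rw [norm_pow, Real.norm_eq_abs, abs_of_nonneg h0]
  refine hgr.trans (le_of_eq ?_)
  ring

end ODE

/-! ### Legendre moments -/

theorem listEval_replicate_append (x : ℝ) (k : ℕ) (p : List ℚ) :
    listEval x (List.replicate k 0 ++ p) = x ^ k * listEval x p := by
  induction k with
  | zero => simp
  | succ k ih => simp [List.replicate_succ, listEval, ih, pow_succ']; ring

theorem continuous_listEval (p : List ℚ) : Continuous fun x => listEval x p := by
  induction p with
  | nil => simpa only [listEval] using continuous_const
  | cons a p ih =>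
    simp only [listEval]
    fun_prop

theorem integral_listEval (p : List ℚ) :
    ∫ x in (0 : ℝ)..1, listEval x p = ((listInt p).sum : ℚ) := by
  rw [intervalIntegral.integral_eq_sub_of_hasDerivAt (fun x _ => hasDerivAt_listInt p x)
    ((continuous_listEval p).intervalIntegrable _ _), listEval_one]
  simp [listInt, listEval]

/-- The coefficient of the `l`-th Legendre polynomial in the expansion of `x ^ k`. -/
def legendreMoment (l k : ℕ) : ℚ :=
  (2 * l + 1) * (listInt (List.replicate k 0 ++ legendreList l)).sum

theorem legendreMoment_eq_integral (l k : ℕ) :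
    (legendreMoment l k : ℝ)
      = (2 * l + 1) * ∫ x in (0 : ℝ)..1, x ^ k * listEval x (legendreList l) := by
  simp only [← listEval_replicate_append, integral_listEval, legendreMoment]
  push_cast
  rfl

theorem legendreMoment_eq_zero_of_lt : ∀ k < 6, ∀ l < 6, k < l → legendreMoment l k = 0 := by
  decide +kernel

theorem legendreMoment_eq_zero_of_le {l : ℕ} (hl : 6 ≤ l) (k : ℕ) : legendreMoment l k = 0 := by
  have h : legendreList l = [] := by
    match l, hl with
    | l + 6, _ => rfl
  have h0 : ∀ n k, (listIntAux n (List.replicate k 0)).sum = 0 := by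
    intro n k
    induction k generalizing n with
    | zero => simp [listIntAux]
    | succ k ih => simp [List.replicate_succ, listIntAux, ih]
  simp [legendreMoment, h, listInt, h0]

/-- A monomial of degree below 6 equals its Legendre expansion. The identity is checked on
coefficient lists and then evaluated. -/
theorem sum_legendreMoment_mul (x : ℝ) {k : ℕ} (hk : k < 6) :
    ∑ l ∈ Finset.range 6, (legendreMoment l k : ℝ) * listEval x (legendreList l) = x ^ k := by
  have h : ∀ k < 6, (List.range 6).foldr (fun l p => listAdd
      ((legendreList l).map (legendreMoment l k * ·)) p) []
        = List.replicate k 0 ++ 1 :: List.replicate (5 - k) 0 := by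
    decide +kernel
  have h' := congrArg (listEval x) (h k hk)
  have h0 : ∀ n, listEval x (List.replicate n 0) = 0 := by
    intro n
    have := listEval_replicate_append x n []
    simpa [listEval] using this
  rw [listEval_replicate_append, listEval, h0] at h'
  simp only [Rat.cast_one, mul_zero, add_zero, mul_one] at h'
  rw [← h']
  simp only [List.range_succ, List.range_zero, List.nil_append, List.foldr_append, List.foldr_cons,
    List.foldr_nil, listEval_add, listEval_map_mul, Finset.sum_range_succ, Finset.sum_range_zero,
    listEval]
  ring

theorem shiftedLegendreP_eq_listEval (x : ℝ) {n : ℕ} (hn : n < 3) :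
    shiftedLegendreP n x = listEval x (legendreList n) := by
  interval_cases n <;> simp [shiftedLegendreP, legendreList, listEval] <;> ring

/-! ### Expansions of the exponentials and of the exact propagator -/

section Expansion

variable {𝔸 : Type u} [NormedRing 𝔸] [NormedAlgebra ℝ 𝔸]

theorem isIteratedIntegral_expWord (c : ℕ → ℝ) :
    IsIteratedIntegral (fun l _ => c l) fun x w => x ^ w.length * expWord c w where
  nil x := by simp [expWord]
  zero l w := by simp
  deriv l w x := by
    refine ((hasDerivAt_pow (w.length + 1) x).mul_const (expWord c (l :: w))).congr_deriv ?_
    simp only [expWord, List.map_cons, List.prod_cons, List.length_cons, Nat.factorial_succ,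
      Nat.add_sub_cancel]
    push_cast
    field_simp

theorem isIteratedIntegral_dysonList :
    IsIteratedIntegral (fun l x => listEval x (legendreList l))
      fun x w => listEval x (dysonList w) where
  nil x := by simp [dysonList, listEval]
  zero l w := by simp [dysonList, listInt, listEval]
  deriv l w x := by
    rw [← listEval_mul]
    exact hasDerivAt_listInt _ x

variable {a : ℝ → ℕ → 𝔸} {M : ℝ}

theorem hasWordExpansion_exp [CompleteSpace 𝔸] {p : ℕ}
    (ha : ∀ᶠ h in 𝓝[>] (0 : ℝ), ∀ l, ‖a h l‖ ≤ M * h ^ (l + 1)) {Ω : ℝ → 𝔸} (c : ℕ → ℝ)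
    (hΩ : ∀ᶠ h in 𝓝[>] (0 : ℝ), ‖Ω h - ∑ l ∈ Finset.range p, c l • a h l‖ ≤ M * h ^ (p + 1)) :
    HasWordExpansion p a (fun h => NormedSpace.exp (Ω h)) (expWord c) := by
  have h := (isIteratedIntegral_expWord c).hasWordExpansion (fun l => continuous_const) p ha
    (Y := fun h x => NormedSpace.exp (x • Ω h)) (B := fun h _ => Ω h)
    (Eventually.of_forall fun h => by simp [NormedSpace.exp_zero])
    (Eventually.of_forall fun h x _ => (hasDerivAt_exp_smul_const' (Ω h) x).hasDerivWithinAt)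
    (hΩ.mono fun h hh x _ => hh)
  simpa using h

/-! ### Legendre letters of the Taylor polynomial -/

/-- Taylor expansion with coefficients in the algebra. -/
theorem exists_taylor_coeff {A : ℝ → 𝔸} {t₀ T : ℝ} (hT : 0 < T) {n : ℕ}
    (hA : ContDiffOn ℝ (n + 1 : ℕ) A (Icc t₀ (t₀ + T))) :
    ∃ (α : ℕ → 𝔸) (C : ℝ), 0 ≤ C ∧ ∀ τ ∈ Icc 0 T,
      ‖A (t₀ + τ) - ∑ k ∈ Finset.range (n + 1), τ ^ k • α k‖ ≤ C * τ ^ (n + 1) := by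
  obtain ⟨C, hC⟩ := exists_taylor_mean_remainder_bound (n := n) (by linarith : t₀ ≤ t₀ + T)
    (by exact_mod_cast hA)
  refine ⟨fun k => ((k.factorial : ℝ)⁻¹) • iteratedDerivWithin k A (Icc t₀ (t₀ + T)) t₀,
    max C 0, le_max_right _ _, fun τ hτ => ?_⟩
  have h := hC (t₀ + τ) ⟨by linarith [hτ.1], by linarith [hτ.2]⟩
  rw [taylor_within_apply, add_sub_cancel_left] at h
  have hτ0 := hτ.1
  refine le_trans (le_of_eq ?_) (h.trans
    (mul_le_mul_of_nonneg_right (le_max_left C 0) (by positivity)))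
  congr 2
  exact Finset.sum_congr rfl fun k _ => by rw [smul_smul, mul_comm]

/-- The Legendre coefficients of the polynomial with coefficients `α`, scaled by `h`. -/
noncomputable def legendreLetter (α : ℕ → 𝔸) (h : ℝ) (l : ℕ) : 𝔸 :=
  ∑ k ∈ Finset.range 6, ((legendreMoment l k : ℝ) * h ^ (k + 1)) • α k

theorem exists_legendreLetter_bound (α : ℕ → 𝔸) :
    ∃ M, 0 ≤ M ∧ ∀ h ∈ Icc (0 : ℝ) 1, ∀ l, ‖legendreLetter α h l‖ ≤ M * h ^ (l + 1) := by
  refine ⟨∑ l ∈ Finset.range 6, ∑ k ∈ Finset.range 6, |(legendreMoment l k : ℝ)| * ‖α k‖,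
    by positivity, fun h hh l => ?_⟩
  by_cases hl : l < 6
  · have h1 : ∑ k ∈ Finset.range 6, |(legendreMoment l k : ℝ)| * ‖α k‖
        ≤ ∑ l ∈ Finset.range 6, ∑ k ∈ Finset.range 6, |(legendreMoment l k : ℝ)| * ‖α k‖ :=
      Finset.single_le_sum (f := fun l => ∑ k ∈ Finset.range 6,
        |(legendreMoment l k : ℝ)| * ‖α k‖) (fun _ _ => by positivity) (Finset.mem_range.2 hl)
    refine le_trans ?_ (mul_le_mul_of_nonneg_right h1 (pow_nonneg hh.1 _))
    rw [Finset.sum_mul]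
    refine norm_sum_le_of_le _ fun k hk => ?_
    -- Orthogonality removes the powers `h ^ (k + 1)` with `k < l`; this is what gives the letter
    -- `l` its weight.
    by_cases hkl : k < l
    · rw [legendreMoment_eq_zero_of_lt k (Finset.mem_range.1 hk) l hl hkl]
      simp
    · rw [norm_smul, norm_mul, norm_pow, Real.norm_eq_abs, Real.norm_eq_abs, abs_of_nonneg hh.1,
        mul_assoc, mul_comm (h ^ (k + 1)), ← mul_assoc]
      exact mul_le_mul_of_nonneg_left (pow_le_pow_of_le_one hh.1 hh.2 (by omega)) (by positivity)
  · have : legendreLetter α h l = 0 :=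
      Finset.sum_eq_zero fun k _ => by rw [legendreMoment_eq_zero_of_le (by omega)]; simp
    rw [this, norm_zero]
    exact mul_nonneg (by positivity) (pow_nonneg hh.1 _)

theorem sum_smul_legendreLetter (α : ℕ → 𝔸) (h x : ℝ) :
    ∑ l ∈ Finset.range 6, listEval x (legendreList l) • legendreLetter α h l
      = h • ∑ k ∈ Finset.range 6, (x * h) ^ k • α k := by
  simp only [legendreLetter, Finset.smul_sum]
  rw [Finset.sum_comm]
  refine Finset.sum_congr rfl fun k hk => ?_
  simp only [smul_smul, ← Finset.sum_smul]
  congr 1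
  rw [mul_pow, ← sum_legendreMoment_mul x (Finset.mem_range.1 hk), Finset.sum_mul, Finset.mul_sum]
  exact Finset.sum_congr rfl fun l _ => by ring

/-- Time is rescaled to `[0, 1]`, so the equation has coefficient `h • A (t₀ + x * h)`. The factor
`h` raises the Taylor remainder `h ^ 6` to the required `h ^ 7`. -/
theorem hasWordExpansion_exactPropagator {A U : ℝ → 𝔸} {t₀ T : ℝ} (hT : 0 < T)
    (hU : IsExactPropagator A U t₀ T) {α : ℕ → 𝔸} (hM : 0 ≤ M)
    (hA : ∀ τ ∈ Icc 0 T, ‖A (t₀ + τ) - ∑ k ∈ Finset.range 6, τ ^ k • α k‖ ≤ M * τ ^ 6)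
    (ha : ∀ᶠ h in 𝓝[>] (0 : ℝ), ∀ l, ‖legendreLetter α h l‖ ≤ M * h ^ (l + 1)) :
    HasWordExpansion 6 (legendreLetter α) (fun h => U (t₀ + h)) fun w => dysonWord w := by
  have h := isIteratedIntegral_dysonList.hasWordExpansion
    (fun l => continuous_listEval (legendreList l)) 6 ha
    (Y := fun h x => U (t₀ + x * h)) (B := fun h x => h • A (t₀ + x * h))
    (Eventually.of_forall fun h => by simp [hU.1]) ?_ ?_
  · simpa [listEval_one, dysonWord] using h
  · filter_upwards [Ioo_mem_nhdsGT hT] with h hh x hx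
    have hmaps : MapsTo (fun x : ℝ => t₀ + x * h) (Icc 0 1) (Icc t₀ (t₀ + T)) := by
      intro y hy
      have h1 := mul_nonneg hy.1 hh.1.le
      have h2 := mul_le_of_le_one_left hh.1.le hy.2
      exact ⟨by linarith, by linarith [hh.2]⟩
    have hd : HasDerivWithinAt (fun x : ℝ => t₀ + x * h) h (Icc 0 1) x := by
      simpa using (((hasDerivAt_id x).mul_const h).const_add t₀).hasDerivWithinAt
    have := (hU.2 _ (hmaps hx)).scomp x hd hmaps
    rw [smul_mul_assoc]
    exact this
  · filter_upwards [Ioo_mem_nhdsGT hT] with h hh x hx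
    have h1 := mul_nonneg hx.1 hh.1.le
    have h2 := mul_le_of_le_one_left hh.1.le hx.2
    have h3 := hA (x * h) ⟨h1, by linarith [hh.2]⟩
    rw [sum_smul_legendreLetter, ← smul_sub, norm_smul, Real.norm_eq_abs, abs_of_pos hh.1]
    calc h * _ ≤ h * (M * (x * h) ^ 6) := mul_le_mul_of_nonneg_left h3 hh.1.le
      _ ≤ h * (M * h ^ 6) := by
          have := hh.1.le
          gcongr
      _ = M * h ^ (6 + 1) := by ring

theorem exists_legendreCoeff_bound [CompleteSpace 𝔸] {A : ℝ → 𝔸} {t₀ T : ℝ}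
    (hAc : ContinuousOn A (Icc t₀ (t₀ + T))) {α : ℕ → 𝔸} (hM : 0 ≤ M)
    (hA : ∀ τ ∈ Icc 0 T, ‖A (t₀ + τ) - ∑ k ∈ Finset.range 6, τ ^ k • α k‖ ≤ M * τ ^ 6)
    {n : ℕ} (hn : n < 3) :
    ∃ C, 0 ≤ C ∧ ∀ h ∈ Ioo 0 T,
      ‖legendreCoeff A t₀ h n - legendreLetter α h n‖ ≤ C * h ^ 7 := by
  obtain ⟨Q, hQ⟩ := isCompact_Icc.exists_bound_of_continuousOn
    (continuous_listEval (legendreList n)).continuousOn (s := Icc (0 : ℝ) 1)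
  have hQ0 : 0 ≤ Q := (norm_nonneg _).trans (hQ 0 (by simp))
  refine ⟨(2 * n + 1) * (Q * M), by positivity, fun h hh => ?_⟩
  have hmaps : MapsTo (fun x : ℝ => t₀ + x * h) (Icc 0 1) (Icc t₀ (t₀ + T)) := by
    intro y hy
    have h1 := mul_nonneg hy.1 hh.1.le
    have h2 := mul_le_of_le_one_left hh.1.le hy.2
    exact ⟨by linarith, by linarith [hh.2]⟩
  set P : ℝ → ℝ := fun x => listEval x (legendreList n) with hP
  have hPc : Continuous P := continuous_listEval _
  have hi1 : IntervalIntegrable (fun x => P x • A (t₀ + x * h)) MeasureTheory.volume 0 1 := by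
    refine ContinuousOn.intervalIntegrable ?_
    rw [uIcc_of_le zero_le_one]
    exact hPc.continuousOn.smul (hAc.comp (by fun_prop) hmaps)
  have hi2 : ∀ k, IntervalIntegrable (fun x => P x • ((x * h) ^ k • α k))
      MeasureTheory.volume 0 1 := fun k => by
    refine Continuous.intervalIntegrable ?_ _ _
    fun_prop
  have hi3 : IntervalIntegrable (fun x => P x • ∑ k ∈ Finset.range 6, (x * h) ^ k • α k)
      MeasureTheory.volume 0 1 := by
    refine Continuous.intervalIntegrable ?_ _ _
    fun_prop
  have hcoeff : legendreCoeff A t₀ h n = ((2 * n + 1) * h) • ∫ x in (0 : ℝ)..1,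
      P x • A (t₀ + x * h) := by
    simp only [legendreCoeff, shiftedLegendreP_eq_listEval _ hn, hP]
  have hletter : legendreLetter α h n = ((2 * n + 1) * h) • ∫ x in (0 : ℝ)..1,
      P x • ∑ k ∈ Finset.range 6, (x * h) ^ k • α k := by
    simp only [Finset.smul_sum]
    rw [intervalIntegral.integral_finsetSum fun k _ => hi2 k, Finset.smul_sum]
    refine Finset.sum_congr rfl fun k _ => ?_
    have h1 : ∀ x : ℝ, P x • ((x * h) ^ k • α k) = (x ^ k * P x) • (h ^ k • α k) := by
      intro x
      rw [smul_smul, smul_smul, mul_pow]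
      congr 1
      ring
    simp only [h1]
    rw [intervalIntegral.integral_smul_const, smul_smul, smul_smul, legendreMoment_eq_integral]
    congr 1
    ring
  rw [hcoeff, hletter, ← smul_sub, ← intervalIntegral.integral_sub hi1 hi3, norm_smul,
    Real.norm_eq_abs, abs_of_nonneg (mul_nonneg (by positivity) hh.1.le)]
  have hint : ‖∫ x in (0 : ℝ)..1, (P x • A (t₀ + x * h)
      - P x • ∑ k ∈ Finset.range 6, (x * h) ^ k • α k)‖ ≤ Q * M * h ^ 6 * |1 - 0| := by
    refine intervalIntegral.norm_integral_le_of_norm_le_const fun x hx => ?_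
    rw [uIoc_of_le zero_le_one] at hx
    have hx : x ∈ Icc (0 : ℝ) 1 := Ioc_subset_Icc_self hx
    have h1 := mul_nonneg hx.1 hh.1.le
    have h2 := mul_le_of_le_one_left hh.1.le hx.2
    rw [← smul_sub, norm_smul, mul_assoc]
    refine mul_le_mul (hQ x hx) ((hA (x * h) ⟨h1, by linarith [hh.2]⟩).trans ?_)
      (norm_nonneg _) hQ0
    gcongr
  rw [sub_zero, abs_one, mul_one] at hint
  have hh0 := hh.1.le
  calc (2 * (n : ℝ) + 1) * h * _ ≤ (2 * (n : ℝ) + 1) * h * (Q * M * h ^ 6) :=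
        mul_le_mul_of_nonneg_left hint (by positivity)
    _ = (2 * n + 1) * (Q * M) * h ^ 7 := by ring

/-! ### Sixth order from the order conditions -/

theorem isOfOrder_six {f : Fin 5 → Fin 3 → ℝ} (hf : IsTimeSymmetric f)
    (hc : SixthOrderConditions f) : IsOfOrder.{u} 6 f := by
  intro 𝔸 _ _ _ A U t₀ T hT hA hU
  obtain ⟨α, C₁, hC₁, hα⟩ := exists_taylor_coeff (n := 5) hT hA
  obtain ⟨C₂, hC₂, hlet⟩ := exists_legendreLetter_bound α
  have hcoeff : ∀ n : Fin 3, ∃ C, 0 ≤ C ∧ ∀ h ∈ Ioo 0 T,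
      ‖legendreCoeff A t₀ h n - legendreLetter α h n‖ ≤ C * h ^ 7 := fun n =>
    exists_legendreCoeff_bound hA.continuousOn hC₁ hα n.2
  choose C₃ hC₃ hcf using hcoeff
  set K := ∑ i, ∑ n, |f i n| * C₃ n with hK
  have hK0 : 0 ≤ K := Finset.sum_nonneg fun i _ => Finset.sum_nonneg fun n _ =>
    mul_nonneg (abs_nonneg _) (hC₃ n)
  -- One constant serves the Taylor remainder, the letters and all five exponents at once; `K` sums
  -- over all rows for this reason.
  set M := C₁ + C₂ + K with hMdef
  have hM : 0 ≤ M := by positivity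
  have hletM : ∀ᶠ h in 𝓝[>] (0 : ℝ), ∀ l, ‖legendreLetter α h l‖ ≤ M * h ^ (l + 1) := by
    filter_upwards [Ioo_mem_nhdsGT (zero_lt_one' ℝ)] with h hh l
    exact (hlet h (Ioo_subset_Icc_self hh) l).trans
      (mul_le_mul_of_nonneg_right (by linarith) (pow_nonneg hh.1.le _))
  have hexp : ∀ i, HasWordExpansion 6 (legendreLetter α)
      (fun h => NormedSpace.exp (exponent (f i) A t₀ h)) (expWord (rowCoeff (f i))) := by
    intro i
    refine hasWordExpansion_exp hletM _ ?_
    filter_upwards [Ioo_mem_nhdsGT hT] with h hh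
    have h1 : exponent (f i) A t₀ h
        - ∑ l ∈ Finset.range 6, rowCoeff (f i) l • legendreLetter α h l
        = ∑ n : Fin 3, f i n • (legendreCoeff A t₀ h n - legendreLetter α h n) := by
      simp [exponent, Finset.sum_range_succ, Fin.sum_univ_three, rowCoeff, smul_sub]
    have h2 : ∑ n, |f i n| * C₃ n ≤ K := Finset.single_le_sum
      (f := fun i => ∑ n, |f i n| * C₃ n) (fun i _ => Finset.sum_nonneg fun n _ =>
        mul_nonneg (abs_nonneg _) (hC₃ n)) (Finset.mem_univ i)
    rw [h1]
    refine le_trans ?_ (mul_le_mul_of_nonneg_right (h2.trans (by linarith : K ≤ M))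
      (pow_nonneg hh.1.le _))
    rw [Finset.sum_mul]
    refine norm_sum_le_of_le _ fun n _ => ?_
    rw [norm_smul, Real.norm_eq_abs, mul_assoc]
    exact mul_le_mul_of_nonneg_left (hcf n h hh) (abs_nonneg _)
  have hprop : HasWordExpansion 6 (legendreLetter α) (fun h => propagator f A t₀ h)
      (propWord f) := by
    have := (hexp 0).mul hletM <| (hexp 1).mul hletM <| (hexp 2).mul hletM <|
      (hexp 3).mul hletM (hexp 4)
    simpa [propagator, propWord, List.ofFn_succ] using this
  have hexact := hasWordExpansion_exactPropagator hT hU hM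
    (fun τ hτ => (hα τ hτ).trans (mul_le_mul_of_nonneg_right (by linarith)
      (pow_nonneg hτ.1 _))) hletM
  refine (IsBigO.sub hprop hexact).congr_left fun h => ?_
  have heq : ∑ k ∈ Finset.range (6 + 1), homPart (legendreLetter α h) (propWord f) k
      = ∑ k ∈ Finset.range (6 + 1),
        homPart (legendreLetter α h) (fun w => (dysonWord w : ℝ)) k :=
    Finset.sum_congr rfl fun k hk => homPart_congr _ fun w hw =>
      propWord_eq_dysonWord hf hc w (by rw [hw]; exact Nat.lt_succ_iff.1 (Finset.mem_range.1 hk))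
  rw [heq]
  abel

end Expansion

/-! ### CF6:4 -/

/-- Cardano's formula: with `s = cf64f11 - 1/2 = u + v` the cubic reads `20 s³ - 5 s - 1 = 0`, which
follows from `u³ + v³ = 1/20` and `u v = 1/12`. -/
theorem cf64f11_cubic : 20 * cf64f11 ^ 3 - 30 * cf64f11 ^ 2 + 10 * cf64f11 - 1 = 0 := by
  have h6 : √6 ^ 2 = 6 := Real.sq_sqrt (by norm_num)
  have h6lt : √6 < 3 := by
    rw [Real.sqrt_lt' (by norm_num)]
    norm_num
  have h60 : 0 ≤ √6 := Real.sqrt_nonneg 6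
  have hcube : ∀ r : ℝ, 0 ≤ r → (r ^ (1 / 3 : ℝ)) ^ 3 = r := by
    intro r hr
    rw [← Real.rpow_natCast, ← Real.rpow_mul hr]
    norm_num
  set u := (5400 - 600 * √6) ^ (1 / 3 : ℝ) / 60 with hu
  set v := (1 / 5 * (9 + √6)) ^ (1 / 3 : ℝ) / (2 * (3 : ℝ) ^ (2 / 3 : ℝ)) with hv
  have hu0 : 0 ≤ u := by
    have : 0 ≤ 5400 - 600 * √6 := by linarith
    positivity
  have hv0 : 0 ≤ v := by positivity
  have hu3 : u ^ 3 = (9 - √6) / 360 := by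
    rw [hu, div_pow, hcube _ (by linarith)]
    ring
  have hv3 : v ^ 3 = (9 + √6) / 360 := by
    have h3 : ((3 : ℝ) ^ (2 / 3 : ℝ)) ^ 3 = 9 := by
      rw [← Real.rpow_natCast, ← Real.rpow_mul (by norm_num)]
      norm_num
    rw [hv, div_pow, mul_pow, hcube _ (by positivity), h3]
    ring
  have huv : u * v = 1 / 12 := by
    have h : (u * v) ^ 3 = (1 / 12) ^ 3 := by
      rw [mul_pow, hu3, hv3]
      linear_combination -(1 / 129600) * h6
    exact (pow_left_inj₀ (mul_nonneg hu0 hv0) (by norm_num) (by norm_num)).1 h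
  have hx : cf64f11 = 1 / 2 + u + v := rfl
  rw [hx]
  linear_combination 20 * hu3 + 20 * hv3 + 60 * (u + v) * huv

theorem one_sub_cf64f11_ne_zero : 1 - cf64f11 ≠ 0 := by
  intro h
  have h1 := cf64f11_cubic
  rw [show cf64f11 = 1 by linarith] at h1
  norm_num at h1

theorem cf64Padded_isTimeSymmetric : IsTimeSymmetric cf64Padded := by
  intro i n
  fin_cases i <;> fin_cases n <;>
    simp [cf64Padded, cf64Table, Fin.rev]

theorem cf64_isTimeSymmetric : IsTimeSymmetric cf64 := by
  intro i n
  fin_cases i <;> fin_cases n <;>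
    simp [cf64, cf64Table, Fin.rev]

theorem cf64Padded_central (n : Fin 3) : cf64Padded 2 n = 0 := by
  fin_cases n <;> rfl

theorem cf64Padded_sixthOrderConditions : SixthOrderConditions cf64Padded := by
  have hx := cf64f11_cubic
  have h1 := one_sub_cf64f11_ne_zero
  have h2 : 1 / (10 - 10 * cf64f11) = 1 / (10 * (1 - cf64f11)) := by ring_nf
  simp only [SixthOrderConditions, cf64Padded, cf64Table, h2, Matrix.cons_val_zero,
    Matrix.cons_val_one, Matrix.cons_val]
  generalize cf64f11 = x at *
  -- Only the last two conditions need the cubic; the other five are identities in `x` once `1 - x ≠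
  -- 0`.
  refine ⟨by ring, by ring, ?_, ?_, ?_, ?_, ?_⟩
  · ring
  · field_simp
    ring
  · field_simp
    ring
  · linear_combination -(1 / 540) * hx
  · linear_combination (1 / 1440) * hx

theorem propagator_cf64Padded {𝔸 : Type u} [NormedRing 𝔸] [NormedAlgebra ℝ 𝔸] (A : ℝ → 𝔸)
    (t₀ h : ℝ) : propagator cf64Padded A t₀ h = propagator cf64 A t₀ h := by
  have h0 : exponent (cf64Table 2) A t₀ h = 0 :=
    Finset.sum_eq_zero fun n _ => by
      rw [show cf64Table 2 n = 0 from cf64Padded_central n, zero_smul]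
  simp [propagator, List.ofFn_succ, cf64Padded, cf64, h0, NormedSpace.exp_zero]

theorem cf64_isOfOrder : IsOfOrder.{u} 6 cf64 := by
  intro 𝔸 _ _ _ A U t₀ T hT hA hU
  simpa only [propagator_cf64Padded] using
    isOfOrder_six cf64Padded_isTimeSymmetric cf64Padded_sixthOrderConditions 𝔸 A U t₀ T hT hA hU

/-! ### The reduction for five exponentials -/

theorem orderPoly_natDegree : orderPoly.natDegree = 5 := by
  have h : orderPoly
      = Polynomial.C (-2 + 30 * Polynomial.X - 192 * Polynomial.X ^ 2 + 680 * Polynomial.X ^ 3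
          - 1440 * Polynomial.X ^ 4 + 1815 * Polynomial.X ^ 5 - 1250 * Polynomial.X ^ 6
          + 360 * Polynomial.X ^ 7)
        + Polynomial.C (18 - 232 * Polynomial.X + 1230 * Polynomial.X ^ 2
          - 3440 * Polynomial.X ^ 3 + 5345 * Polynomial.X ^ 4 - 4350 * Polynomial.X ^ 5
          + 1440 * Polynomial.X ^ 6) * Polynomial.X
        + Polynomial.C (-60 + 650 * Polynomial.X - 2740 * Polynomial.X ^ 2
          + 5655 * Polynomial.X ^ 3 - 5710 * Polynomial.X ^ 4 + 2250 * Polynomial.X ^ 5)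
          * Polynomial.X ^ 2
        + Polynomial.C (90 - 800 * Polynomial.X + 2535 * Polynomial.X ^ 2
          - 3450 * Polynomial.X ^ 3 + 1710 * Polynomial.X ^ 4) * Polynomial.X ^ 3
        + Polynomial.C (-60 + 425 * Polynomial.X - 920 * Polynomial.X ^ 2
          + 630 * Polynomial.X ^ 3) * Polynomial.X ^ 4
        + Polynomial.C (15 - 80 * Polynomial.X + 90 * Polynomial.X ^ 2) * Polynomial.X ^ 5 := by
    simp only [orderPoly, map_add, map_sub, map_mul, map_pow, map_neg, map_ofNat]
  have hlead : (15 - 80 * Polynomial.X + 90 * Polynomial.X ^ 2 : Polynomial ℝ) ≠ 0 := by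
    intro h0
    have := congrArg (Polynomial.eval 0) h0
    simp at this
  rw [h]
  compute_degree!

theorem orderPoly_evalEval (x y : ℝ) :
    orderPoly.evalEval x y =
      (-2 + 30 * x - 192 * x ^ 2 + 680 * x ^ 3 - 1440 * x ^ 4 + 1815 * x ^ 5 - 1250 * x ^ 6
        + 360 * x ^ 7)
      + (18 - 232 * x + 1230 * x ^ 2 - 3440 * x ^ 3 + 5345 * x ^ 4 - 4350 * x ^ 5
        + 1440 * x ^ 6) * y
      + (-60 + 650 * x - 2740 * x ^ 2 + 5655 * x ^ 3 - 5710 * x ^ 4 + 2250 * x ^ 5) * y ^ 2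
      + (90 - 800 * x + 2535 * x ^ 2 - 3450 * x ^ 3 + 1710 * x ^ 4) * y ^ 3
      + (-60 + 425 * x - 920 * x ^ 2 + 630 * x ^ 3) * y ^ 4
      + (15 - 80 * x + 90 * x ^ 2) * y ^ 5 := by
  simp [orderPoly, Polynomial.evalEval]

/-- After eliminating `e` and `g`, `c3` is linear in `a` and `b`, and combined with `c7` it yields
`b`. Conditions `c4`, `c5` are linear in `c`, `d` with determinant `remDenom` up to a nonzero
constant, so Cramer's rule applies. Condition `c6` involves neither `c` nor `d`. -/
theorem sixthOrderConditions_iff {f : Fin 5 → Fin 3 → ℝ}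
    (hnd : Nondegenerate (f 0 0) (f 1 0)) :
    SixthOrderConditions f ↔
      orderPoly.evalEval (f 0 0) (f 1 0) = 0 ∧
      f 1 1 = rem22 (f 0 0) (f 1 0) ∧
      f 0 1 = rem12 (f 0 0) (f 1 0) ∧
      f 0 2 = rem13 (f 0 0) (f 1 0) ∧
      f 1 2 = rem23 (f 0 0) (f 1 0) ∧
      f 2 0 = 1 - 2 * f 0 0 - 2 * f 1 0 ∧
      f 2 2 = -2 * f 0 2 - 2 * f 1 2 := by
  simp only [SixthOrderConditions, orderPoly_evalEval]
  generalize f 0 0 = x, f 0 1 = a, f 0 2 = c, f 1 0 = y, f 1 1 = b, f 1 2 = d, f 2 0 = e,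
    f 2 2 = g at *
  obtain ⟨hu, hv, hw, hx, hD⟩ := hnd
  have hb : b = rem22 x y ↔
      b * (30 * (x + y - 1) * (x + y) * (2 * x + y - 1)) = 1 + 5 * x * (x - 1) :=
    eq_div_iff (by simp [hu, hv, hw])
  have ha : b = rem22 x y → (a = rem12 x y ↔
      a * (6 * (1 - x)) = 1 - 6 * b + 12 * x * b + 6 * y * b) := by
    intro h
    rw [rem12, ← h]
    exact eq_div_iff (by simp [hx])
  have hcd : b = rem22 x y → a = rem12 x y →
      remDenom x y = a * (2 * x - 1) * (2 * x + y - 1)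
        + b * (1 + 8 * x ^ 2 + 2 * (y - 2) * y + (8 * y - 7) * x) ∧
      (c = rem13 x y ↔ c * (30 * remDenom x y) = (2 * x - 1) * (2 * x + y - 1) - 3 * b) ∧
      (d = rem23 x y ↔ d * (30 * remDenom x y)
        = x + 3 * a + 4 * x * y + 2 * (y - 1) * y + 6 * b - 1) := by
    intro h1 h2
    refine ⟨by rw [remDenom, ← h1, ← h2], ?_, ?_⟩
    · rw [rem13, ← h1]
      exact eq_div_iff (by simp [hD])
    · rw [rem23, ← h1, ← h2]
      exact eq_div_iff (by simp [hD])
  have hpoly : b = rem22 x y → a = rem12 x y →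
      (1 / 60 + (-(1 / 3 * x * a ^ 2) - y * a * b - y * a ^ 2 - 1 / 3 * y * b ^ 2
          - (1 - 2 * x - 2 * y) * a * b - 1 / 2 * (1 - 2 * x - 2 * y) * a ^ 2
          - 1 / 2 * (1 - 2 * x - 2 * y) * b ^ 2))
        -- This factor clears the denominators of the squares of `a` and `b`; a single power of `x +
        -- y` suffices, the other one cancels.
        * (5400 * (x + y - 1) ^ 2 * (x + y) * (2 * x + y - 1) ^ 2 * (1 - x) ^ 2)
      = orderPoly.evalEval x y := by
    intro h1 h2
    rw [rem12, ← h1] at h2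
    rw [rem22] at h1
    rw [orderPoly_evalEval, h2, h1]
    -- With `w` as a variable in place of `y`, the three linear denominators become `w`, `w - x` and
    -- `w + 1 - x`.
    obtain ⟨w, hw'⟩ : ∃ w, 2 * x + y - 1 = w := ⟨_, rfl⟩
    obtain rfl : y = w + 1 - 2 * x := by linarith
    rw [show 2 * x + (w + 1 - 2 * x) - 1 = w by ring] at hw ⊢
    rw [show x + (w + 1 - 2 * x) - 1 = w - x by ring] at hu ⊢
    rw [show x + (w + 1 - 2 * x) = w + 1 - x by ring] at hv ⊢
    field_simp
    ring
  rw [orderPoly_evalEval] at hpoly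
  have hfac : 5400 * (x + y - 1) ^ 2 * (x + y) * (2 * x + y - 1) ^ 2 * (1 - x) ^ 2 ≠ 0 := by
    simp [hu, hv, hw, hx]
  constructor
  · rintro ⟨c1, c2, c3, c4, c5, c6, c7⟩
    obtain rfl : e = 1 - 2 * x - 2 * y := by linarith
    obtain rfl : g = -2 * c - 2 * d := by linarith
    -- The multiple of `c3` is chosen to eliminate `a` from `c7`.
    have eb : b = rem22 x y := hb.2 (by linear_combination -360 * c7 - 30 * x * (1 - x) * c3)
    have ea : a = rem12 x y := (ha eb).2 (by linear_combination 6 * c3)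
    obtain ⟨eD, ec, ed⟩ := hcd eb ea
    refine ⟨?_, eb, ea, ec.2 ?_, ed.2 ?_, rfl, rfl⟩
    · rw [← hpoly eb ea]
      linear_combination (-(5400 * (x + y - 1) ^ 2 * (x + y) * (2 * x + y - 1) ^ 2
        * (1 - x) ^ 2)) * c6
    · rw [eD]
      linear_combination 30 * (2 * x - 1) * (2 * x + y - 1) * c4 + 180 * b * c5
    · rw [eD]
      linear_combination -180 * (a + 2 * b) * c5
        + 30 * (x + 4 * x * y + 2 * (y - 1) * y - 1) * c4
  · rintro ⟨hp, eb, ea, ec, ed, rfl, rfl⟩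
    obtain ⟨eD, ec', ed'⟩ := hcd eb ea
    have kb := hb.1 eb
    have ka := (ha eb).1 ea
    have kc := ec'.1 ec
    have kd := ed'.1 ed
    rw [← hpoly eb ea] at hp
    have k6 := (mul_eq_zero.1 hp).resolve_right hfac
    refine ⟨by ring, by ring, by linear_combination (1 / 6) * ka, ?_, ?_,
      by linear_combination -k6, ?_⟩
    -- Cramer's rule read backwards: the linear condition is recovered after multiplication by the
    -- nonzero determinant.
    · refine mul_left_cancel₀ hD ?_
      rw [eD] at kc kd ⊢
      linear_combination (1 / 30) * (a + 2 * b) * kc + (1 / 30) * b * kd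
    · refine mul_left_cancel₀ hD ?_
      rw [eD] at kc kd ⊢
      linear_combination (1 / 180) * (x + 4 * x * y + 2 * (y - 1) * y - 1) * kc
        - (1 / 180) * ((2 * x - 1) * (2 * x + y - 1)) * kd
    · linear_combination -(1 / 360) * kb - (1 / 72) * x * (1 - x) * ka

end CFET

/-! ### The assembled theorem -/

theorem mainTheorem6 :
    -- CF6:4 is time-symmetric, satisfies the seven order conditions with a vanishing third row,
    -- amounts to four exponentials, and is of sixth order
    (CFET.IsTimeSymmetric CFET.cf64Padded ∧ CFET.IsTimeSymmetric CFET.cf64 ∧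
      (∀ n, CFET.cf64Padded 2 n = 0) ∧
      CFET.SixthOrderConditions CFET.cf64Padded ∧
      (∀ (𝔸 : Type u) [NormedRing 𝔸] [NormedAlgebra ℝ 𝔸] (A : ℝ → 𝔸) (t₀ h : ℝ),
        CFET.propagator CFET.cf64Padded A t₀ h = CFET.propagator CFET.cf64 A t₀ h) ∧
      CFET.IsOfOrder.{u} 6 CFET.cf64) ∧
    -- the order conditions for five exponentials give sixth order
    (∀ f : Fin 5 → Fin 3 → ℝ, CFET.IsTimeSymmetric f → CFET.SixthOrderConditions f →
      CFET.IsOfOrder.{u} 6 f) ∧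
    -- apart from degenerate cases they reduce to one polynomial equation of degree five
    CFET.orderPoly.natDegree = 5 ∧
    (∀ f : Fin 5 → Fin 3 → ℝ, CFET.IsTimeSymmetric f → CFET.Nondegenerate (f 0 0) (f 1 0) →
      (CFET.SixthOrderConditions f ↔
        CFET.orderPoly.evalEval (f 0 0) (f 1 0) = 0 ∧
        f 1 1 = CFET.rem22 (f 0 0) (f 1 0) ∧
        f 0 1 = CFET.rem12 (f 0 0) (f 1 0) ∧
        f 0 2 = CFET.rem13 (f 0 0) (f 1 0) ∧
        f 1 2 = CFET.rem23 (f 0 0) (f 1 0) ∧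
        f 2 0 = 1 - 2 * f 0 0 - 2 * f 1 0 ∧
        f 2 2 = -2 * f 0 2 - 2 * f 1 2)) :=
  ⟨⟨CFET.cf64Padded_isTimeSymmetric, CFET.cf64_isTimeSymmetric, CFET.cf64Padded_central,
      CFET.cf64Padded_sixthOrderConditions,
      fun _ _ _ A t₀ h => CFET.propagator_cf64Padded A t₀ h, CFET.cf64_isOfOrder⟩,
    fun _ hf hc => CFET.isOfOrder_six hf hc, CFET.orderPoly_natDegree,
    fun _ _ hnd => CFET.sixthOrderConditions_iff hnd⟩
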